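/- Let $k,n\ge 1$. For a probability measure $\pi$ on $[0,\infty)$ (a prior), let $(\theta_1,X_1),\dots,(\theta_n,X_n)$ be i.i.d. with $\theta_i\sim\pi$ and $X_i\mid\theta_i\sim\mathrm{Poi}(\theta_i)$. Let $\mathsf{mmse}_k(\pi)=\inf_{t:\mathbb Z_{\ge 0}\to\mathbb R}\mathbb E[(t(X_1)-\theta_1^k)^2]$, and for an estimator $\hat T=(\hat T_1,\dots,\hat T_n):\mathbb Z_{\ge 0}^n\to\mathbb R^n$ let its individual regret be $$\mathsf{Regret}_{\pi,k,n}(\hat T)=\mathbb E\big[(\hat T_n(X_1,\dots,X_n)-\theta_n^k)^2\big]-\mathsf{mmse}_k(\pi).$$ Let $\mathcal P([0,h])$ be the set of priors with $\pi([0,h])=1$, and $\mathsf{SubE}(s)$ the set of priors with $\pi[\theta\ge t]\le 2e^{-t/s}$ for all $t>0$. Let $\mathcal F_\uparrow$ be the set of non-decreasing functions $t:\mathbb Z_{\ge 0}\to[0,\infty)$ and $\mathcal F_{\uparrow,b}$ the set of those $t\in\mathcal F_\uparrow$ with values in $[0,b]$. For $x\in\mathbb Z_{\ge 0}^n$ put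 $$\hat R_k(t)=\frac1n\sum_{i=1}^n\Big[t(x_i)^2-2(x_i-k+1)_k\,t(x_i-k)\Big],\qquad (x-k+1)_k=x(x-1)\cdots(x-k+1),$$ where the second term is $0$ when $x_i<k$. An ERM estimator $\hat T_{\mathsf{erm},k}$ is a map $x\mapsto(\hat t(x_1),\dots,\hat t(x_n))$ where, for each sample $x$, $\hat t$ is a minimizer of $\hat R_k$ over $\mathcal F_\uparrow$; a clipped ERM estimator $\hat T_{\mathsf{erm},k,b}$ is defined in the same way with $\mathcal F_{\uparrow,b}$ in place of $\mathcal F_\uparrow$. **Theorem.** Such estimators exist (for every $n$, $k$ and $b=h^k$, $h\ge0$), and any choice of them satisfies the following. 1. There are absolute constants $A,B>0$ such that for all $k\ge 2$, $h\ge 0$ and $n\ge 3$, $$\sup_{\pi\in\mathcal P([0,h])}\mathsf{Regret}_{\pi,k,n}(\hat T_{\mathsf{erm},k,h^k})\le (A+Bh)^{2k+1}\frac1n\Big(\frac{\log n}{\log\log n}\Big)^{k+1}+\frac{\big[2(Ah+Bh^2)\frac{\log n}{\log\log n}(1+2k)\big]^k}{n^3}.$$ Moreover, for all $k\ge 1$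 and $h\ge 0$ there is a constant $C=C(h,k)>0$ such that for all $n\ge 3$ $$\sup_{\pi\in\mathcal P([0,h])}\mathsf{Regret}_{\pi,k,n}(\hat T_{\mathsf{erm},k,h^k})\le \frac{C}{n}\Big(\frac{\log n}{\log\log n}\Big)^{k+1}.$$ 2. For all $k\ge 1$ and $s>0$ there is a constant $C=C(s,k)>0$ such that for all $n\ge 2$ $$\sup_{\pi\in\mathsf{SubE}(s)}\mathsf{Regret}_{\pi,k,n}(\hat T_{\mathsf{erm},k})\le C\,\frac{(\log n)^{2k+1}}{n}.$$ -/

import Mathlib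

open MeasureTheory ProbabilityTheory
open scoped NNReal ENNReal

namespace PoissonEB

/-- The Poisson model `θ ↦ Poi(θ)`, as a Markov kernel from the parameter space `[0, ∞)` to `ℕ`. -/
noncomputable def poissonKernel : Kernel ℝ≥0 ℕ where
  toFun := poissonMeasure
  measurable' := by
    refine Measure.measurable_of_measurable_coe _ fun s _ => ?_
    have h : (fun r : ℝ≥0 => poissonMeasure r s) = fun r : ℝ≥0 =>
        ∑' x : ℕ, s.indicator
          (fun x : ℕ => ENNReal.ofReal (Real.exp (-(r : ℝ)) * (r : ℝ) ^ x / (x.factorial : ℝ))) x := by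
      funext r
      rw [← Measure.tsum_indicator_apply_singleton _ _ (MeasurableSet.of_discrete)]
      simp only [poissonMeasure_singleton]
    rw [h]
    refine Measurable.tsum fun x => ?_
    by_cases hx : x ∈ s
    · simp only [Set.indicator_of_mem hx]
      fun_prop
    · simp only [Set.indicator_of_notMem hx]
      fun_prop

instance : IsMarkovKernel poissonKernel where
  isProbabilityMeasure r := (inferInstance : IsProbabilityMeasure (poissonMeasure r))

/-- The joint law of `(θ, X)`, where `θ ∼ π` and, given `θ`, `X ∼ Poi(θ)`. -/
noncomputable def jointLaw (π : ProbabilityMeasure ℝ≥0) : Measure (ℝ≥0 × ℕ) :=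
  (π : Measure ℝ≥0) ⊗ₘ poissonKernel

/-- The joint law of `n` i.i.d. pairs `(θ₁, X₁), …, (θₙ, Xₙ)`. -/
noncomputable def sampleLaw (π : ProbabilityMeasure ℝ≥0) (n : ℕ) :
    Measure (Fin n → ℝ≥0 × ℕ) :=
  Measure.pi fun _ => jointLaw π

/-- The minimal mean squared error `min_t E[(t(X) - θ ^ k) ^ 2]` under the prior `π`. -/
noncomputable def mmse (k : ℕ) (π : ProbabilityMeasure ℝ≥0) : ℝ≥0∞ :=
  ⨅ t : ℕ → ℝ, ∫⁻ p, ENNReal.ofReal ((t p.2 - (p.1 : ℝ) ^ k) ^ 2) ∂(jointLaw π)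

/-- The index of the last observation. -/
def lastIndex (n : ℕ) (hn : 0 < n) : Fin n := ⟨n - 1, Nat.sub_lt hn Nat.one_pos⟩

/-- The mean squared error `E[(Tₙ(X₁, …, Xₙ) - θₙ ^ k) ^ 2]` of the last coordinate of `T`. -/
noncomputable def lastMSE (k n : ℕ) (hn : 0 < n) (π : ProbabilityMeasure ℝ≥0)
    (T : (Fin n → ℕ) → Fin n → ℝ) : ℝ≥0∞ :=
  ∫⁻ ω, ENNReal.ofReal
    ((T (fun i => (ω i).2) (lastIndex n hn) - ((ω (lastIndex n hn)).1 : ℝ) ^ k) ^ 2)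
    ∂(sampleLaw π n)

/-- The individual regret of the estimator `T` of `θ ^ k` under the prior `π`. -/
noncomputable def individualRegret (k n : ℕ) (hn : 0 < n) (π : ProbabilityMeasure ℝ≥0)
    (T : (Fin n → ℕ) → Fin n → ℝ) : EReal :=
  (lastMSE k n hn π T : EReal) - (mmse k π : EReal)

/-- `𝒫([0, h])`: the priors that are supported on `[0, h]`. -/
def boundedPriors (h : ℝ≥0) : Set (ProbabilityMeasure ℝ≥0) :=
  {π | (π : Measure ℝ≥0) (Set.Icc 0 h) = 1}

/-- `SubE(s)`: the priors with `π[θ ≥ t] ≤ 2 exp (-t / s)` for all `t > 0`. -/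
def subexponentialPriors (s : ℝ) : Set (ProbabilityMeasure ℝ≥0) :=
  {π | ∀ t : ℝ, 0 < t →
    (π : Measure ℝ≥0) {θ | t ≤ (θ : ℝ)} ≤ ENNReal.ofReal (2 * Real.exp (-t / s))}

/-- The class of monotone functions from `ℕ` to `[0, ∞)`. -/
def monotoneClass : Set (ℕ → ℝ) :=
  {t | (∀ x, 0 ≤ t x) ∧ ∀ x, t x ≤ t (x + 1)}

/-- The class of monotone functions from `ℕ` to `[0, ∞)` with values in `[a, b]`. -/
def clippedMonotoneClass (a b : ℝ) : Set (ℕ → ℝ) :=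
  {t | t ∈ monotoneClass ∧ ∀ x, a ≤ t x ∧ t x ≤ b}

/-- The empirical objective `(1/n) ∑ᵢ [t(Xᵢ)² - 2 (Xᵢ - k + 1)ₖ t(Xᵢ - k)]`. The rising factorial
`(x - k + 1)ₖ = (x - k + 1) ⋯ (x - 1) x` is the falling factorial `x.descFactorial k`. It is `0`
for `x < k`, so that the value of `t` at the truncated difference `x - k` is then irrelevant. -/
noncomputable def empiricalRisk (k : ℕ) {n : ℕ} (x : Fin n → ℕ) (t : ℕ → ℝ) : ℝ :=
  (1 / (n : ℝ)) * ∑ i, (t (x i) ^ 2 - 2 * ((x i).descFactorial k : ℝ) * t (x i - k))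

/-- `T` is an empirical risk minimization estimator of `θ ^ k` over the function class `F`: on
every sample `x` one has `T x = (t (x₁), …, t (xₙ))` for some minimizer `t` of the empirical
objective over `F`. -/
def IsERM (F : Set (ℕ → ℝ)) (k n : ℕ) (T : (Fin n → ℕ) → Fin n → ℝ) : Prop :=
  ∀ x : Fin n → ℕ, ∃ t ∈ F, IsMinOn (empiricalRisk k x) F t ∧ T x = fun i => t (x i)

end PoissonEB

open PoissonEB

namespace PoissonEB

/-! ### Empirical risk minimization over monotone functions -/

/-! The Bayes rule `bayes k π` is non-decreasing, and it lies in the clipped class when the prior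
lives on `[0, h]`. Since the minimum mean squared error is that of the Bayes rule, the regret is at
most the mean squared distance from the estimator to the Bayes rule (`lastMSE_eq`). The empirical
risk is strictly convex in the values on the sample, so any choice of minimizer is permutation
equivariant (`IsERM.comp_perm`). Hence `n` times this distance is the expected total training error
`E ∑ᵢ (t(Xᵢ) - bayes(Xᵢ))²`.

Convexity of the class gives a basic inequality for the training error (`sum_sq_sub_le_of_isMinOn`).
Write `N_y` for the number of observations equal to `y` and `c_y = (y + k)ₖ`. A nonempty cell costs
`(N_y bayes(y) - c_y N_{y+k})² / N_y`; an empty one costs `2 c_y N_{y+k} t(y)`. The Poisson identity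
`c_y P(y + k) = bayes(y) P(y)` centres `N_y bayes(y) - c_y N_{y+k}`. An exact size-bias exchange
between the two counts then bounds the expected cost of a nonempty cell by `(3 bayes² + 2 c_y bayes)
min(1, n P(y))` (`lintegral_cell_sq_div_le`). Each cell thus costs a quantity independent of `n`,
and only the number of cells that matter remains to be found.

For bounded priors, about `L = log n / log log n` cells matter, each costing order `L^k`. If `k ≥
2L`, then `L^(k+1) ≥ n` and the trivial bound suffices, so the constants are uniform in `k`. For
subexponential priors about `log n` cells matter, each costing order `(log n)^(2k)`; the unclipped
minimizer is controlled by the largest response, and the rest by exponential moments. -/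

theorem monotone_of_mem_monotoneClass {t : ℕ → ℝ} (ht : t ∈ monotoneClass) : Monotone t :=
  monotone_nat_of_le_succ ht.2

theorem convex_monotoneClass : Convex ℝ monotoneClass := by
  intro s hs t ht a b ha hb _
  refine ⟨fun x => ?_, fun x => ?_⟩
  · simp only [Pi.add_apply, Pi.smul_apply, smul_eq_mul]
    have := hs.1 x
    have := ht.1 x
    positivity
  · simp only [Pi.add_apply, Pi.smul_apply, smul_eq_mul]
    have := mul_le_mul_of_nonneg_left (hs.2 x) ha
    have := mul_le_mul_of_nonneg_left (ht.2 x) hb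
    linarith

theorem convex_clippedMonotoneClass (a b : ℝ) : Convex ℝ (clippedMonotoneClass a b) := by
  intro s hs t ht u v hu hv huv
  refine ⟨convex_monotoneClass hs.1 ht.1 hu hv huv, fun x => ?_⟩
  exact convex_Icc a b (hs.2 x) (ht.2 x) hu hv huv

theorem isCompact_clippedMonotoneClass (a b : ℝ) : IsCompact (clippedMonotoneClass a b) := by
  have hc : IsCompact (Set.pi Set.univ fun _ : ℕ => Set.Icc a b) :=
    isCompact_univ_pi fun _ => isCompact_Icc
  have : clippedMonotoneClass a b
      = (Set.pi Set.univ fun _ : ℕ => Set.Icc a b) ∩ monotoneClass := by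
    ext t
    simp only [clippedMonotoneClass, Set.mem_ofPred_eq, Set.mem_inter_iff, Set.mem_pi,
      Set.mem_univ, forall_const, Set.mem_Icc]
    exact and_comm
  rw [this]
  refine hc.inter_right ?_
  have h : monotoneClass = (⋂ x : ℕ, {t : ℕ → ℝ | 0 ≤ t x}) ∩ ⋂ x : ℕ, {t | t x ≤ t (x + 1)} := by
    ext t
    simp [monotoneClass]
  rw [h]
  refine (isClosed_iInter fun x => ?_).inter (isClosed_iInter fun x => ?_)
  · exact isClosed_le continuous_const (continuous_apply x)
  · exact isClosed_le (continuous_apply x) (continuous_apply (x + 1))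

theorem continuous_empiricalRisk (k : ℕ) {n : ℕ} (x : Fin n → ℕ) :
    Continuous (empiricalRisk k x) := by
  unfold empiricalRisk
  fun_prop

theorem exists_isMinOn_clippedMonotoneClass (k : ℕ) {n : ℕ} (x : Fin n → ℕ) {b : ℝ} (hb : 0 ≤ b) :
    ∃ t ∈ clippedMonotoneClass 0 b, IsMinOn (empiricalRisk k x) (clippedMonotoneClass 0 b) t :=
  (isCompact_clippedMonotoneClass 0 b).exists_isMinOn
    ⟨0, ⟨fun _ => le_rfl, fun _ => le_rfl⟩, fun _ => ⟨le_rfl, hb⟩⟩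
    (continuous_empiricalRisk k x).continuousOn

theorem min_const_mem_clippedMonotoneClass {t : ℕ → ℝ} (ht : t ∈ monotoneClass) {b : ℝ}
    (hb : 0 ≤ b) : (fun y => min (t y) b) ∈ clippedMonotoneClass 0 b :=
  ⟨⟨fun x => le_min (ht.1 x) hb, fun x => min_le_min_right _ (ht.2 x)⟩,
    fun x => ⟨le_min (ht.1 x) hb, min_le_right _ _⟩⟩

/-- Truncating a monotone function at an upper bound of the responses lowers the risk. -/
theorem empiricalRisk_min_add_le (k : ℕ) {n : ℕ} (x : Fin n → ℕ) {t : ℕ → ℝ}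
    (ht : t ∈ monotoneClass) {b : ℝ} (hb : ∀ i, ((x i).descFactorial k : ℝ) ≤ b) :
    empiricalRisk k x (fun y => min (t y) b)
        + (1 / (n : ℝ)) * ∑ i, (t (x i) - min (t (x i)) b) ^ 2 ≤ empiricalRisk k x t := by
  unfold empiricalRisk
  rw [← mul_add, ← Finset.sum_add_distrib]
  refine mul_le_mul_of_nonneg_left (Finset.sum_le_sum fun i _ => ?_) (by positivity)
  have hm := monotone_of_mem_monotoneClass ht (Nat.sub_le (x i) k)
  have hD : (0 : ℝ) ≤ ((x i).descFactorial k : ℝ) := by positivity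
  have hbi := hb i
  dsimp only
  rcases le_total (t (x i)) b with h | h
  · rw [min_eq_left h, min_eq_left (hm.trans h)]
    simp
  · rw [min_eq_right h]
    rcases le_total (t (x i - k)) b with h' | h'
    · rw [min_eq_left h']
      nlinarith [mul_nonneg (sub_nonneg.2 h) (hD.trans hbi)]
    · rw [min_eq_right h']
      -- Monotonicity of `t` enters here: with `D ≤ b` and `t(x - k) ≤ t(x)`, the loss `2D(t(x - k)
      -- - b)` is at most the gain `2b(t(x) - b)`.
      nlinarith [mul_le_mul hbi (sub_le_sub_right hm b) (sub_nonneg.2 h') (hD.trans hbi)]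

/-- The unclipped class is not compact, but truncating at an upper bound of the responses never
raises the risk, so a minimizer over the class clipped there is global. The sum of the responses
serves as the bound, which also covers `n = 0`. -/
theorem exists_isMinOn_monotoneClass (k : ℕ) {n : ℕ} (x : Fin n → ℕ) :
    ∃ t ∈ monotoneClass, IsMinOn (empiricalRisk k x) monotoneClass t := by
  have hb : ∀ i, ((x i).descFactorial k : ℝ) ≤ ∑ j, ((x j).descFactorial k : ℝ) := fun i =>
    Finset.single_le_sum (f := fun j => ((x j).descFactorial k : ℝ)) (fun j _ => by positivity)
      (Finset.mem_univ i)
  have hb0 : (0 : ℝ) ≤ ∑ j, ((x j).descFactorial k : ℝ) := by positivity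
  obtain ⟨t, ht, hmin⟩ := exists_isMinOn_clippedMonotoneClass k x hb0
  refine ⟨t, ht.1, fun s hs => ?_⟩
  have h1 := hmin (min_const_mem_clippedMonotoneClass hs hb0)
  have h2 := empiricalRisk_min_add_le k x hs hb
  have h3 : 0 ≤ (1 / (n : ℝ)) * ∑ i, (s (x i) - min (s (x i))
    (∑ j, ((x j).descFactorial k : ℝ))) ^ 2 := by positivity
  simp only [Set.mem_ofPred_eq] at h1 ⊢
  linarith

theorem exists_isERM {F : Set (ℕ → ℝ)} {k n : ℕ}
    (h : ∀ x : Fin n → ℕ, ∃ t ∈ F, IsMinOn (empiricalRisk k x) F t) : ∃ T, IsERM F k n T := by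
  choose t htF ht using h
  exact ⟨fun x i => t x (x i), fun x => ⟨t x, htF x, ht x, rfl⟩⟩

/-- The variational inequality that characterizes a minimizer over a convex class. -/
theorem variational_of_isMinOn {F : Set (ℕ → ℝ)} (hF : Convex ℝ F) {k n : ℕ} (hn : 0 < n)
    {x : Fin n → ℕ} {t s : ℕ → ℝ} (ht : t ∈ F) (hmin : IsMinOn (empiricalRisk k x) F t)
    (hs : s ∈ F) :
    0 ≤ ∑ i, (t (x i) * (s (x i) - t (x i))
      - ((x i).descFactorial k : ℝ) * (s (x i - k) - t (x i - k))) := by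
  set lin := ∑ i, (t (x i) * (s (x i) - t (x i))
      - ((x i).descFactorial k : ℝ) * (s (x i - k) - t (x i - k))) with hlin
  set q := ∑ i, (s (x i) - t (x i)) ^ 2 with hq
  have hn' : (0 : ℝ) < n := by exact_mod_cast hn
  -- On the segment from `t` to `s` the risk is quadratic: `n` times its increment is `l * (2 * lin
  -- + l * q)`.
  have key : ∀ l : ℝ, 0 < l → l ≤ 1 → 0 ≤ 2 * lin + l * q := by
    intro l hl hl1
    have hmem : (1 - l) • t + l • s ∈ F := hF ht hs (by linarith) hl.le (by ring)
    have h := hmin hmem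
    simp only [Set.mem_ofPred_eq, empiricalRisk] at h
    rw [mul_le_mul_iff_right₀ (by positivity)] at h
    have e : ∑ i, (((1 - l) • t + l • s) (x i) ^ 2
        - 2 * ((x i).descFactorial k : ℝ) * ((1 - l) • t + l • s) (x i - k))
        = ∑ i, (t (x i) ^ 2 - 2 * ((x i).descFactorial k : ℝ) * t (x i - k))
          + l * (2 * lin + l * q) := by
      rw [hlin, hq, Finset.mul_sum, Finset.mul_sum, ← Finset.sum_add_distrib, Finset.mul_sum,
        ← Finset.sum_add_distrib]
      refine Finset.sum_congr rfl fun i _ => ?_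
      simp only [Pi.add_apply, Pi.smul_apply, smul_eq_mul]
      ring
    rw [e] at h
    exact nonneg_of_mul_nonneg_right (by linarith) hl
  by_contra hneg
  push Not at hneg
  have hq0 : 0 ≤ q := by positivity
  rcases hq0.eq_or_lt with h0 | h0
  · have := key 1 one_pos le_rfl
    rw [← h0] at this
    linarith
  -- If `lin < 0`, this `l` makes `2 * lin + l * q ≤ lin < 0`.
  · have h1 := key (min 1 (-lin / q)) (lt_min one_pos (div_pos (by linarith) h0)) (min_le_left _ _)
    have h2 : min 1 (-lin / q) * q ≤ -lin := by
      calc min 1 (-lin / q) * q ≤ -lin / q * q :=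
            mul_le_mul_of_nonneg_right (min_le_right _ _) hq0
        _ = -lin := by field_simp
    linarith

/-- Adding the variational inequalities of the two minimizers cancels the responses and leaves `-∑
(t - s)² ≥ 0` on the sample. Off the sample a minimizer need not be unique. -/
theorem eq_on_sample_of_isMinOn {F : Set (ℕ → ℝ)} (hF : Convex ℝ F) {k n : ℕ} (hn : 0 < n)
    {x : Fin n → ℕ} {t s : ℕ → ℝ} (ht : t ∈ F) (htmin : IsMinOn (empiricalRisk k x) F t)
    (hs : s ∈ F) (hsmin : IsMinOn (empiricalRisk k x) F s) (i : Fin n) : t (x i) = s (x i) := by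
  have h1 := variational_of_isMinOn hF hn ht htmin hs
  have h2 := variational_of_isMinOn hF hn hs hsmin ht
  have h3 : ∑ i, (t (x i) - s (x i)) ^ 2 ≤ 0 := by
    have h := add_nonneg h1 h2
    rw [← Finset.sum_add_distrib] at h
    have e : ∑ i, (t (x i) - s (x i)) ^ 2 = -∑ i, ((t (x i) * (s (x i) - t (x i))
      - ((x i).descFactorial k : ℝ) * (s (x i - k) - t (x i - k))) +
      (s (x i) * (t (x i) - s (x i))
      - ((x i).descFactorial k : ℝ) * (t (x i - k) - s (x i - k)))) := by
      rw [← Finset.sum_neg_distrib]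
      exact Finset.sum_congr rfl fun i _ => by ring
    linarith
  have h4 := (Finset.sum_eq_zero_iff_of_nonneg fun i _ => sq_nonneg (t (x i) - s (x i))).1
    (le_antisymm h3 (by positivity)) i (Finset.mem_univ i)
  exact sub_eq_zero.1 (pow_eq_zero_iff two_ne_zero |>.1 h4)

theorem empiricalRisk_comp_perm (k : ℕ) {n : ℕ} (x : Fin n → ℕ) (σ : Equiv.Perm (Fin n)) :
    empiricalRisk k (x ∘ σ) = empiricalRisk k x := by
  funext t
  unfold empiricalRisk
  congr 1
  exact Equiv.sum_comp σ fun i => t (x i) ^ 2 - 2 * ((x i).descFactorial k : ℝ) * t (x i - k)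

/-- The risk sees the sample only as a multiset, so a permuted sample has the same minimizers, and
these agree on the sample. All coordinates of the estimator are therefore exchangeable, however ties
are broken. -/
theorem IsERM.comp_perm {F : Set (ℕ → ℝ)} (hF : Convex ℝ F) {k n : ℕ} (hn : 0 < n)
    {T : (Fin n → ℕ) → Fin n → ℝ} (hT : IsERM F k n T) (x : Fin n → ℕ) (σ : Equiv.Perm (Fin n))
    (i : Fin n) : T (x ∘ σ) i = T x (σ i) := by
  obtain ⟨t, htF, htmin, ht⟩ := hT x
  obtain ⟨s, hsF, hsmin, hs⟩ := hT (x ∘ σ)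
  rw [ht, hs]
  rw [empiricalRisk_comp_perm] at hsmin
  exact (eq_on_sample_of_isMinOn hF hn htF htmin hsF hsmin (σ i)).symm

/-- Otherwise truncation at `b` would lower the risk strictly, by the mean squared excess. This
replaces clipping for the unclipped estimator. -/
theorem le_of_isMinOn_monotoneClass {k n : ℕ} (hn : 0 < n) {x : Fin n → ℕ} {t : ℕ → ℝ}
    (ht : t ∈ monotoneClass) (hmin : IsMinOn (empiricalRisk k x) monotoneClass t) {b : ℝ}
    (hb : ∀ i, ((x i).descFactorial k : ℝ) ≤ b) (i : Fin n) : t (x i) ≤ b := by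
  have hb0 : 0 ≤ b := le_trans (by positivity) (hb i)
  have h1 := empiricalRisk_min_add_le k x ht hb
  have h2 := hmin (min_const_mem_clippedMonotoneClass ht hb0).1
  simp only [Set.mem_ofPred_eq] at h2
  have hn' : (0 : ℝ) < 1 / n := by positivity
  have h3 : ∑ i, (t (x i) - min (t (x i)) b) ^ 2 ≤ 0 := by
    by_contra h
    push Not at h
    have := mul_pos hn' h
    linarith
  have h4 := (Finset.sum_eq_zero_iff_of_nonneg
    fun i _ => sq_nonneg (t (x i) - min (t (x i)) b)).1
    (le_antisymm h3 (by positivity)) i (Finset.mem_univ i)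
  have h5 := sub_eq_zero.1 (pow_eq_zero_iff two_ne_zero |>.1 h4)
  rw [h5]
  exact min_le_right _ _

/-- The number of observations equal to `a`. -/
def cellCount {n : ℕ} (a : ℕ) (x : Fin n → ℕ) : ℕ := {i | x i = a}.toFinset.card

theorem sum_comp_eq_sum_cellCount {n R : ℕ} {x : Fin n → ℕ} (hR : ∀ i, x i < R) (g : ℕ → ℝ) :
    ∑ i, g (x i) = ∑ y ∈ Finset.range R, (cellCount y x : ℝ) * g y := by
  rw [← Finset.sum_fiberwise_of_maps_to (t := Finset.range R) (g := x)
    (fun i _ => Finset.mem_range.2 (hR i))]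
  refine Finset.sum_congr rfl fun y _ => ?_
  rw [Finset.sum_congr rfl (g := fun _ => g y)
    (fun i hi => by rw [(Finset.mem_filter.1 hi).2])]
  simp [cellCount]

theorem sum_descFactorial_eq_sum_cellCount {n R : ℕ} {x : Fin n → ℕ} (hR : ∀ i, x i < R) (k : ℕ)
    (g : ℕ → ℝ) :
    ∑ i, ((x i).descFactorial k : ℝ) * g (x i - k)
      = ∑ y ∈ Finset.range R, ((y + k).descFactorial k : ℝ) * cellCount (y + k) x * g y := by
  rw [sum_comp_eq_sum_cellCount (R := R + k) (fun i => (hR i).trans_le (Nat.le_add_right _ _))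
    (fun a => (a.descFactorial k : ℝ) * g (a - k)), add_comm R k, Finset.sum_range_add]
  rw [Finset.sum_eq_zero, zero_add]
  · refine Finset.sum_congr rfl fun y _ => ?_
    rw [add_comm k y, Nat.add_sub_cancel]
    ring
  · intro a ha
    rw [Nat.descFactorial_eq_zero_iff_lt.2 (Finset.mem_range.1 ha)]
    simp

/-- The basic inequality for the empirical error of a minimizer, split into the cells `{x = y}`. -/
theorem sum_sq_sub_le_of_isMinOn {F : Set (ℕ → ℝ)} (hF : Convex ℝ F) {k n R : ℕ} (hn : 0 < n)
    {x : Fin n → ℕ} (hR : ∀ i, x i < R) {t s : ℕ → ℝ} (ht : t ∈ F)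
    (hmin : IsMinOn (empiricalRisk k x) F t) (hs : s ∈ F) (hs0 : ∀ y, 0 ≤ s y) :
    ∑ i, (t (x i) - s (x i)) ^ 2 ≤ ∑ y ∈ Finset.range R,
      ((cellCount y x * s y - (y + k).descFactorial k * cellCount (y + k) x) ^ 2 / cellCount y x
        + 2 * (if cellCount y x = 0 then
          (y + k).descFactorial k * cellCount (y + k) x * t y else 0)) := by
  have h := variational_of_isMinOn hF hn ht hmin hs
  rw [Finset.sum_sub_distrib, sum_comp_eq_sum_cellCount hR (fun a => t a * (s a - t a)),
    sum_descFactorial_eq_sum_cellCount hR k (fun a => s a - t a), ← Finset.sum_sub_distrib] at h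
  rw [sum_comp_eq_sum_cellCount hR (fun a => (t a - s a) ^ 2)]
  -- Twice the variational inequality is added. With `N = N_y` and `w = c_y N_{y+k}`, completing the
  -- square gives `N(t - s)² + 2(N t - w)(s - t) = (N s - w)²/N - (N t - w)²/N`. In an empty cell
  -- the quotient is `0` by convention and `2w(t - s) ≤ 2wt` remains.
  have key : ∀ y ∈ Finset.range R, (cellCount y x : ℝ) * (t y - s y) ^ 2
      + 2 * (cellCount y x * (t y * (s y - t y))
        - (y + k).descFactorial k * cellCount (y + k) x * (s y - t y)) ≤
      (cellCount y x * s y - (y + k).descFactorial k * cellCount (y + k) x) ^ 2 / cellCount y x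
        + 2 * (if cellCount y x = 0 then
          ((y + k).descFactorial k : ℝ) * cellCount (y + k) x * t y else 0) := by
    intro y _
    have hc : (0 : ℝ) ≤ (y + k).descFactorial k * cellCount (y + k) x := by positivity
    set w : ℝ := (y + k).descFactorial k * cellCount (y + k) x
    by_cases h0 : cellCount y x = 0
    · simp only [h0, if_true, Nat.cast_zero, zero_mul, div_zero, zero_add, zero_sub]
      nlinarith [mul_nonneg hc (hs0 y)]
    · have hN : (0 : ℝ) < cellCount y x := by
        exact_mod_cast Nat.pos_of_ne_zero h0
      set N : ℝ := ((cellCount y x : ℕ) : ℝ)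
      rw [if_neg h0, mul_zero, add_zero, le_div_iff₀ hN]
      nlinarith [sq_nonneg (N * t y - w)]
  have := Finset.sum_le_sum key
  rw [Finset.sum_add_distrib, ← Finset.mul_sum] at this
  linarith

/-! ### Cell counts of an i.i.d. sample -/

theorem cellCount_le {n : ℕ} (a : ℕ) (x : Fin n → ℕ) : cellCount a x ≤ n := by
  simpa [cellCount] using Finset.card_le_univ ({i | x i = a}.toFinset)

theorem cellCount_cast_eq_sum {n : ℕ} (a : ℕ) (x : Fin n → ℕ) :
    (cellCount a x : ℝ≥0∞) = ∑ i, if x i = a then 1 else 0 := by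
  simp [cellCount]

theorem cellCount_update_self {n : ℕ} {a : ℕ} {x : Fin n → ℕ} {i : Fin n} (hi : x i ≠ a) :
    cellCount a (Function.update x i a) = cellCount a x + 1 := by
  have h : {j | Function.update x i a j = a}.toFinset = insert i {j | x j = a}.toFinset := by
    ext j
    by_cases hj : j = i <;> simp [hj, Function.update_apply]
  rw [cellCount, h, Finset.card_insert_of_notMem (by simpa using hi), cellCount]

theorem cellCount_update_of_ne {n : ℕ} {a : ℕ} {x : Fin n → ℕ} {i : Fin n} (hi : x i ≠ a) :
    cellCount (x i) (Function.update x i a) = cellCount (x i) x - 1 := by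
  have h : {j | Function.update x i a j = x i}.toFinset = {j | x j = x i}.toFinset.erase i := by
    ext j
    by_cases hj : j = i
    · subst hj
      simp [hi.symm]
    · simp [hj, Function.update_apply]
  rw [cellCount, h, Finset.card_erase_of_mem (by simp), cellCount]

/-- The permutation of the sample space that exchanges the values `a` and `b` in coordinate `i`. -/
def swapValues {n : ℕ} (i : Fin n) (a b : ℕ) : Equiv.Perm (Fin n → ℕ) :=
  Function.Involutive.toPerm (fun x => Function.update x i (Equiv.swap a b (x i))) fun x => by
    simp

section

variable {n : ℕ} (P : Measure ℕ) [IsProbabilityMeasure P]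

theorem pi_singleton_update (x : Fin n → ℕ) (i : Fin n) (a : ℕ) (c t : ℝ≥0∞)
    (h : c * P {a} = t * P {x i}) :
    c * Measure.pi (fun _ : Fin n => P) {Function.update x i a}
      = t * Measure.pi (fun _ : Fin n => P) {x} := by
  rw [Measure.pi_singleton, Measure.pi_singleton, ← Finset.mul_prod_erase _ _ (Finset.mem_univ i),
    ← Finset.mul_prod_erase _ (fun j => P {x j}) (Finset.mem_univ i), ← mul_assoc, ← mul_assoc,
    Function.update_self, h]
  congr 1
  refine Finset.prod_congr rfl fun j hj => ?_
  rw [Function.update_of_ne (Finset.ne_of_mem_erase hj)]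

/-- Swapping the values `a` and `b` in coordinate `i` maps `{x i = b}` onto `{x i = a}` and changes
the mass by the ratio `P {a} / P {b}`; `c` and `t` state this without division. -/
theorem lintegral_exchange_value (i : Fin n) {a b : ℕ} {c t : ℝ≥0∞} (h : c * P {a} = t * P {b})
    (G : (Fin n → ℕ) → ℝ≥0∞) :
    c * ∫⁻ x, (if x i = a then G x else 0) ∂(Measure.pi fun _ : Fin n => P)
      = t * ∫⁻ x, (if x i = b then G (Function.update x i a) else 0)
        ∂(Measure.pi fun _ : Fin n => P) := by
  rw [lintegral_countable', lintegral_countable', ← ENNReal.tsum_mul_left, ← ENNReal.tsum_mul_left,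
    ← Equiv.tsum_eq (swapValues i a b)]
  refine tsum_congr fun x => ?_
  have hx : swapValues i a b x = Function.update x i (Equiv.swap a b (x i)) := rfl
  rw [hx, Function.update_self]
  by_cases hb : x i = b
  · rw [hb, Equiv.swap_apply_right, if_pos rfl, if_pos rfl, mul_left_comm,
      pi_singleton_update P x i a c t (by rw [h, hb]), mul_left_comm]
  · rw [if_neg hb, if_neg]
    · simp
    · exact fun h' => hb ((Equiv.swap a b).injective (h'.trans (Equiv.swap_apply_right a b).symm))

/-- A size-bias identity for two cell counts of an i.i.d. sample. -/
theorem lintegral_cellCount_exchange {a b : ℕ} (hab : a ≠ b) {c t : ℝ≥0∞}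
    (h : c * P {a} = t * P {b}) (g : ℕ → ℕ → ℝ≥0∞) :
    c * ∫⁻ x, cellCount a x * g (cellCount a x) (cellCount b x)
        ∂(Measure.pi fun _ : Fin n => P)
      = t * ∫⁻ x, cellCount b x * g (cellCount a x + 1) (cellCount b x - 1)
        ∂(Measure.pi fun _ : Fin n => P) := by
  simp_rw [cellCount_cast_eq_sum, Finset.sum_mul, ite_mul, one_mul, zero_mul]
  rw [lintegral_finsetSum _ fun i _ => Measurable.of_discrete,
    lintegral_finsetSum _ fun i _ => Measurable.of_discrete, Finset.mul_sum, Finset.mul_sum]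
  refine Finset.sum_congr rfl fun i _ => ?_
  rw [lintegral_exchange_value P i h]
  congr 1
  refine lintegral_congr fun x => ?_
  by_cases hb : x i = b
  · have hi : x i ≠ a := fun h' => hab (h'.symm.trans hb)
    rw [if_pos hb, if_pos hb, cellCount_update_self hi]
    have := cellCount_update_of_ne hi
    rw [hb] at this
    rw [this]
  · rw [if_neg hb, if_neg hb]

theorem lintegral_cellCount (a : ℕ) :
    ∫⁻ x, (cellCount a x : ℝ≥0∞) ∂(Measure.pi fun _ : Fin n => P) = n * P {a} := by
  simp_rw [cellCount_cast_eq_sum]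
  rw [lintegral_finsetSum _ fun i _ => Measurable.of_discrete]
  have : ∀ i : Fin n, ∫⁻ x, (if x i = a then 1 else 0) ∂(Measure.pi fun _ : Fin n => P) = P {a} := by
    intro i
    rw [(measurePreserving_eval (fun _ : Fin n => P) i).lintegral_comp
      (f := fun y => if y = a then 1 else 0) Measurable.of_discrete, lintegral_countable']
    rw [tsum_eq_single a (fun b hb => by simp [hb])]
    simp
  simp [this]

theorem integrable_cellCount (a b : ℕ) (F : ℕ → ℕ → ℝ) :
    Integrable (fun x => F (cellCount a x) (cellCount b x)) (Measure.pi fun _ : Fin n => P) := by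
  refine Integrable.of_bound (C := ∑ i ∈ Finset.range (n + 1), ∑ j ∈ Finset.range (n + 1), |F i j|)
    (Measurable.of_discrete.aestronglyMeasurable) (Filter.Eventually.of_forall fun x => ?_)
  have ha := Finset.mem_range.2 (Nat.lt_succ_of_le (cellCount_le a x))
  have hb := Finset.mem_range.2 (Nat.lt_succ_of_le (cellCount_le b x))
  refine le_trans ?_ (Finset.single_le_sum (f := fun i => ∑ j ∈ Finset.range (n + 1), |F i j|)
    (fun i _ => by positivity) ha)
  exact Finset.single_le_sum (f := fun j => |F (cellCount a x) j|) (fun i _ => by positivity) hb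

theorem integral_cellCount_exchange {a b : ℕ} (hab : a ≠ b) {c t : ℝ} (hc : 0 ≤ c) (ht : 0 ≤ t)
    (h : c * P.real {a} = t * P.real {b}) (g : ℕ → ℕ → ℝ) (hg : ∀ i j, 0 ≤ g i j) :
    c * ∫ x, cellCount a x * g (cellCount a x) (cellCount b x)
        ∂(Measure.pi fun _ : Fin n => P)
      = t * ∫ x, cellCount b x * g (cellCount a x + 1) (cellCount b x - 1)
        ∂(Measure.pi fun _ : Fin n => P) := by
  have h' : ENNReal.ofReal c * P {a} = ENNReal.ofReal t * P {b} := by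
    rw [← ofReal_measureReal, ← ofReal_measureReal, ← ENNReal.ofReal_mul hc,
      ← ENNReal.ofReal_mul ht, h]
  have key := lintegral_cellCount_exchange (n := n) P hab h' fun i j => ENNReal.ofReal (g i j)
  rw [integral_eq_lintegral_of_nonneg_ae
      (Filter.Eventually.of_forall fun x => mul_nonneg (Nat.cast_nonneg _) (hg _ _))
      Measurable.of_discrete.aestronglyMeasurable,
    integral_eq_lintegral_of_nonneg_ae
      (Filter.Eventually.of_forall fun x => mul_nonneg (Nat.cast_nonneg _) (hg _ _))
      Measurable.of_discrete.aestronglyMeasurable]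
  have key' := congrArg ENNReal.toReal key
  rw [ENNReal.toReal_mul, ENNReal.toReal_mul, ENNReal.toReal_ofReal hc,
    ENNReal.toReal_ofReal ht] at key'
  simpa only [ENNReal.ofReal_mul (Nat.cast_nonneg _), ENNReal.ofReal_natCast] using key'

/-- The integrand left once the exchange has removed the count of `a`; `N` is the count of `b`. For
`N ≥ 3` the linear growth cancels: the `t²` part is `t² N/(N - 2) ≤ 3t²`, and `N/(N - 1) ≤ 2`. For
`N ≤ 2` truncated subtraction and `1 / 0 = 0` decide the value. -/
theorem cell_polynomial_le {c t : ℝ} (hc : 0 ≤ c) (ht : 0 ≤ t) (N : ℕ) :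
    t ^ 2 * N - 2 * (t ^ 2 * (N * if N - 1 = 0 then 0 else 1))
      + t ^ 2 * (N * (((N - 1 : ℕ) : ℝ) / ((N - 1 - 1 : ℕ) : ℝ)))
      + t * c * (N * (1 / ((N - 1 : ℕ) : ℝ)))
      ≤ (3 * t ^ 2 + 2 * (c * t)) * if N = 0 then 0 else 1 := by
  have hct := mul_nonneg hc ht
  match N with
  | 0 => simp
  | 1 => simp; nlinarith [sq_nonneg t]
  | 2 => norm_num; nlinarith [sq_nonneg t]
  | m + 3 =>
    have e1 : m + 3 - 1 = m + 2 := rfl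
    have e2 : m + 2 - 1 = m + 1 := rfl
    have hm : (0 : ℝ) ≤ m := Nat.cast_nonneg m
    simp only [e1, e2, Nat.add_eq_zero_iff, OfNat.ofNat_ne_zero, and_false, if_false, mul_one]
    push_cast
    have h1 : ((m : ℝ) + 3) * ((m + 2) / (m + 1)) ≤ m + 3 + 3 := by
      rw [← mul_div_assoc, div_le_iff₀ (by positivity)]
      nlinarith
    have h2 : ((m : ℝ) + 3) * (1 / (m + 2)) ≤ 2 := by
      rw [← mul_div_assoc, div_le_iff₀ (by positivity)]
      nlinarith
    nlinarith [mul_le_mul_of_nonneg_left h1 (sq_nonneg t), mul_le_mul_of_nonneg_left h2 hct]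

/-- By `h` the difference inside the square has mean zero. Its square, divided by the count of `b`,
therefore has expectation bounded independently of `n`. -/
theorem integral_cell_sq_div_le {a b : ℕ} (hab : a ≠ b) {c t : ℝ} (hc : 0 ≤ c) (ht : 0 ≤ t)
    (h : c * P.real {a} = t * P.real {b}) :
    ∫ x, (cellCount b x * t - c * cellCount a x) ^ 2 / cellCount b x
        ∂(Measure.pi fun _ : Fin n => P)
      ≤ (3 * t ^ 2 + 2 * (c * t)) *
        ∫ x, (if cellCount b x = 0 then 0 else 1 : ℝ) ∂(Measure.pi fun _ : Fin n => P) := by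
  set Q := Measure.pi fun _ : Fin n => P
  have hint := fun F : ℕ → ℕ → ℝ => integrable_cellCount (n := n) P a b F
  have pal := fun (g : ℕ → ℕ → ℝ) (hg : ∀ i j, 0 ≤ g i j) =>
    integral_cellCount_exchange (n := n) P hab hc ht h g hg
  -- `p1` treats the cross term, `p2` followed by `p3` the term in `N_a (N_a - 1) / N_b`, and `p4`
  -- the remaining `N_a / N_b`.
  have p1 := pal (fun _ j => if j = 0 then 0 else 1) (fun i j => by split_ifs <;> norm_num)
  have p2 := pal (fun i j => ((i - 1 : ℕ) : ℝ) / j) (fun i j => by positivity)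
  have p3 := pal (fun i j => (j : ℝ) / ((j - 1 : ℕ) : ℝ)) (fun i j => by positivity)
  have p4 := pal (fun i j => 1 / (j : ℝ)) (fun i j => by positivity)
  simp only [Nat.add_sub_cancel] at p2
  have e2 : ∫ x, (cellCount b x : ℝ) * ((cellCount a x : ℝ) / ((cellCount b x - 1 : ℕ) : ℝ)) ∂Q
      = ∫ x, (cellCount a x : ℝ) * ((cellCount b x : ℝ) / ((cellCount b x - 1 : ℕ) : ℝ)) ∂Q :=
    integral_congr_ae (Filter.Eventually.of_forall fun x => by ring)
  rw [e2] at p2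
  have exp : ∀ x : Fin n → ℕ, (cellCount b x * t - c * cellCount a x) ^ 2 / cellCount b x
      = t ^ 2 * cellCount b x
        - 2 * t * c * (cellCount a x * if cellCount b x = 0 then 0 else 1)
        + c ^ 2 * (cellCount a x * (((cellCount a x - 1 : ℕ) : ℝ) / cellCount b x))
        + c ^ 2 * (cellCount a x * (1 / (cellCount b x : ℝ))) := by
    intro x
    by_cases h0 : cellCount b x = 0
    · simp [h0]
    · have h0' : (cellCount b x : ℝ) ≠ 0 := by exact_mod_cast h0
      rw [if_neg h0]
      rcases Nat.eq_zero_or_pos (cellCount a x) with h1 | h1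
      · simp only [h1, Nat.cast_zero]
        field_simp
        ring
      · rw [Nat.cast_sub h1]
        field_simp
        push_cast
        ring
  simp_rw [exp]
  rw [integral_add, integral_add, integral_sub, integral_const_mul, integral_const_mul,
    integral_const_mul, integral_const_mul]
  rotate_left
  · exact hint fun i j => t ^ 2 * j
  · exact hint fun i j => 2 * t * c * (i * if j = 0 then 0 else 1)
  · exact hint fun i j => t ^ 2 * j - 2 * t * c * (i * if j = 0 then 0 else 1)
  · exact hint fun i j => c ^ 2 * (i * (((i - 1 : ℕ) : ℝ) / j))
  · exact hint fun i j => t ^ 2 * j - 2 * t * c * (i * if j = 0 then 0 else 1)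
      + c ^ 2 * (i * (((i - 1 : ℕ) : ℝ) / j))
  · exact hint fun i j => c ^ 2 * (i * (1 / (j : ℝ)))
  have bound := integral_mono
    (hint fun i j => t ^ 2 * j - 2 * (t ^ 2 * (j * if j - 1 = 0 then 0 else 1))
      + t ^ 2 * (j * (((j - 1 : ℕ) : ℝ) / ((j - 1 - 1 : ℕ) : ℝ)))
      + t * c * (j * (1 / ((j - 1 : ℕ) : ℝ))))
    (hint fun i j => (3 * t ^ 2 + 2 * (c * t)) * if j = 0 then 0 else 1)
    (fun x => cell_polynomial_le hc ht (cellCount b x))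
  rw [integral_add, integral_add, integral_sub, integral_const_mul, integral_const_mul,
    integral_const_mul, integral_const_mul, integral_const_mul, integral_const_mul] at bound
  rotate_left
  · exact hint fun i j => t ^ 2 * j
  · exact hint fun i j => 2 * (t ^ 2 * (j * if j - 1 = 0 then 0 else 1))
  · exact hint fun i j => t ^ 2 * j - 2 * (t ^ 2 * (j * if j - 1 = 0 then 0 else 1))
  · exact hint fun i j => t ^ 2 * (j * (((j - 1 : ℕ) : ℝ) / ((j - 1 - 1 : ℕ) : ℝ)))
  · exact hint fun i j => t ^ 2 * j - 2 * (t ^ 2 * (j * if j - 1 = 0 then 0 else 1))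
      + t ^ 2 * (j * (((j - 1 : ℕ) : ℝ) / ((j - 1 - 1 : ℕ) : ℝ)))
  · exact hint fun i j => t * c * (j * (1 / ((j - 1 : ℕ) : ℝ)))
  refine le_trans (le_of_eq ?_) bound
  linear_combination (-2 * t) * p1 + c * p2 + t * p3 + c * p4

theorem lintegral_cellCount_pos_le (b : ℕ) :
    ∫⁻ x, (if cellCount b x = 0 then 0 else 1) ∂(Measure.pi fun _ : Fin n => P)
      ≤ min 1 (n * P {b}) := by
  refine le_min ?_ ?_
  · calc _ ≤ ∫⁻ _, 1 ∂(Measure.pi fun _ : Fin n => P) :=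
          lintegral_mono fun x => by split_ifs <;> simp
      _ = 1 := by simp
  · rw [← lintegral_cellCount]
    refine lintegral_mono fun x => ?_
    split_ifs with h
    · simp
    · exact Nat.one_le_cast.2 (Nat.one_le_iff_ne_zero.2 h)

theorem lintegral_cell_sq_div_le {a b : ℕ} (hab : a ≠ b) {c t : ℝ} (hc : 0 ≤ c) (ht : 0 ≤ t)
    (h : c * P.real {a} = t * P.real {b}) :
    ∫⁻ x, ENNReal.ofReal ((cellCount b x * t - c * cellCount a x) ^ 2 / cellCount b x)
        ∂(Measure.pi fun _ : Fin n => P)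
      ≤ ENNReal.ofReal (3 * t ^ 2 + 2 * (c * t)) * min 1 (n * P {b}) := by
  have h1 := integral_cell_sq_div_le (n := n) P hab hc ht h
  refine le_trans ?_ (mul_le_mul_right (lintegral_cellCount_pos_le P b) _)
  rw [← ofReal_integral_eq_lintegral_ofReal
    (integrable_cellCount P a b fun i j => (j * t - c * i) ^ 2 / j)
    (Filter.Eventually.of_forall fun x => by positivity)]
  refine (ENNReal.ofReal_le_ofReal h1).trans (le_of_eq ?_)
  rw [ENNReal.ofReal_mul (by positivity), ofReal_integral_eq_lintegral_ofReal
    (integrable_cellCount P a b fun i j => if j = 0 then 0 else 1)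
    (Filter.Eventually.of_forall fun x => by dsimp only; split_ifs <;> simp)]
  congr 1
  refine lintegral_congr fun x => ?_
  split_ifs <;> simp

/-- The exchange turns the event that `b` is unobserved into the event that `b` is observed exactly
once. -/
theorem lintegral_cellCount_empty_le {a b : ℕ} (hab : a ≠ b) {c t : ℝ} (hc : 0 ≤ c) (ht : 0 ≤ t)
    (h : c * P.real {a} = t * P.real {b}) :
    ∫⁻ x, ENNReal.ofReal (if cellCount b x = 0 then c * cellCount a x else 0)
        ∂(Measure.pi fun _ : Fin n => P)
      ≤ ENNReal.ofReal t * min 1 (n * P {b}) := by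
  have h' : ENNReal.ofReal c * P {a} = ENNReal.ofReal t * P {b} := by
    rw [← ofReal_measureReal, ← ofReal_measureReal, ← ENNReal.ofReal_mul hc,
      ← ENNReal.ofReal_mul ht, h]
  have key := lintegral_cellCount_exchange (n := n) P hab h' fun _ j => if j = 0 then 1 else 0
  refine le_trans (le_of_eq ?_) (key.le.trans (mul_le_mul_right (le_trans ?_
    (lintegral_cellCount_pos_le P b)) _))
  · rw [← lintegral_const_mul _ Measurable.of_discrete]
    refine lintegral_congr fun x => ?_
    split_ifs
    · rw [ENNReal.ofReal_mul hc, ENNReal.ofReal_natCast, mul_one]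
    · simp
  · refine lintegral_mono fun x => ?_
    match cellCount b x with
    | 0 => simp
    | 1 => simp
    | m + 2 => simp

end

/-! ### The Bayes estimator -/

/-- The probability that a Poisson variable with mean `θ` equals `x`. -/
noncomputable def poissonWeight (x : ℕ) (θ : ℝ≥0) : ℝ :=
  Real.exp (-(θ : ℝ)) * (θ : ℝ) ^ x / (x.factorial : ℝ)

theorem poissonWeight_nonneg (x : ℕ) (θ : ℝ≥0) : 0 ≤ poissonWeight x θ := by
  unfold poissonWeight
  positivity

@[fun_prop]
theorem measurable_poissonWeight (x : ℕ) : Measurable (poissonWeight x) := by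
  unfold poissonWeight
  fun_prop

/-- This identity makes the falling factorial of an observation an unbiased response for `θ ^ j`,
shifted by `j` cells. -/
theorem pow_mul_poissonWeight (j x : ℕ) (θ : ℝ≥0) :
    (θ : ℝ) ^ j * poissonWeight x θ
      = ((x + j).descFactorial j : ℝ) * poissonWeight (x + j) θ := by
  have h := Nat.factorial_mul_descFactorial (Nat.le_add_left j x)
  rw [Nat.add_sub_cancel] at h
  unfold poissonWeight
  rw [← h]
  push_cast
  have h1 : ((x + j).descFactorial j : ℝ) ≠ 0 := by
    exact_mod_cast (Nat.pos_of_ne_zero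
      (fun h0 => absurd (Nat.descFactorial_eq_zero_iff_lt.1 h0) (by omega))).ne'
  field_simp
  ring

theorem poissonWeight_le_one (x : ℕ) (θ : ℝ≥0) : poissonWeight x θ ≤ 1 := by
  have h := Real.pow_div_factorial_le_exp (θ : ℝ) θ.2 x
  unfold poissonWeight
  rw [mul_div_assoc]
  calc Real.exp (-(θ : ℝ)) * ((θ : ℝ) ^ x / x.factorial)
      ≤ Real.exp (-(θ : ℝ)) * Real.exp θ := mul_le_mul_of_nonneg_left h (Real.exp_nonneg _)
    _ = 1 := by rw [← Real.exp_add]; simp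

theorem tsum_ofReal_poissonWeight (θ : ℝ≥0) : ∑' x, ENNReal.ofReal (poissonWeight x θ) = 1 := by
  have h := measure_univ (μ := poissonMeasure θ)
  rw [← lintegral_one, lintegral_countable'] at h
  simpa only [one_mul, poissonMeasure_singleton, poissonWeight] using h

theorem lintegral_jointLaw (π : ProbabilityMeasure ℝ≥0) {f : ℝ≥0 × ℕ → ℝ≥0∞}
    (hf : Measurable f) :
    ∫⁻ p, f p ∂(jointLaw π)
      = ∑' x, ∫⁻ θ, f (θ, x) * ENNReal.ofReal (poissonWeight x θ) ∂(π : Measure ℝ≥0) := by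
  have hfx : ∀ x, Measurable fun θ => f (θ, x) := fun x => hf.comp (by fun_prop)
  rw [jointLaw, Measure.lintegral_compProd hf, ← lintegral_tsum fun x => by fun_prop]
  refine lintegral_congr fun θ => ?_
  rw [lintegral_countable']
  refine tsum_congr fun x => ?_
  rw [show poissonKernel θ = poissonMeasure θ from rfl, poissonMeasure_singleton]
  rfl

instance (π : ProbabilityMeasure ℝ≥0) : IsProbabilityMeasure (jointLaw π) := by
  unfold jointLaw
  infer_instance

/-- The law of one observation. -/
noncomputable def obsLaw (π : ProbabilityMeasure ℝ≥0) : Measure ℕ := (jointLaw π).map Prod.snd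

instance (π : ProbabilityMeasure ℝ≥0) : IsProbabilityMeasure (obsLaw π) :=
  Measure.isProbabilityMeasure_map measurable_snd.aemeasurable

/-- The moment `E[θ ^ j; X = x]`. -/
noncomputable def cellMoment (π : ProbabilityMeasure ℝ≥0) (j x : ℕ) : ℝ :=
  ∫ θ, (θ : ℝ) ^ j * poissonWeight x θ ∂(π : Measure ℝ≥0)

/-- The posterior mean `E[θ ^ k | X = x]`. -/
noncomputable def bayes (k : ℕ) (π : ProbabilityMeasure ℝ≥0) (x : ℕ) : ℝ :=
  cellMoment π k x / cellMoment π 0 x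

section

variable (π : ProbabilityMeasure ℝ≥0)

/-- Restricted to one cell, every moment is finite for every prior: the shift identity bounds the
integrand. -/
theorem integrable_pow_mul_poissonWeight (j x : ℕ) :
    Integrable (fun θ : ℝ≥0 => (θ : ℝ) ^ j * poissonWeight x θ) (π : Measure ℝ≥0) := by
  refine Integrable.of_bound (C := ((x + j).descFactorial j : ℝ))
    (by fun_prop) (Filter.Eventually.of_forall fun θ => ?_)
  rw [pow_mul_poissonWeight, Real.norm_of_nonneg
    (mul_nonneg (Nat.cast_nonneg _) (poissonWeight_nonneg _ _))]
  exact mul_le_of_le_one_right (Nat.cast_nonneg _) (poissonWeight_le_one _ _)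

theorem cellMoment_nonneg (j x : ℕ) : 0 ≤ cellMoment π j x :=
  integral_nonneg fun θ => mul_nonneg (by positivity) (poissonWeight_nonneg _ _)

theorem cellMoment_eq_descFactorial_mul (j x : ℕ) :
    cellMoment π j x = ((x + j).descFactorial j : ℝ) * cellMoment π 0 (x + j) := by
  simp only [cellMoment, pow_mul_poissonWeight j x, integral_const_mul, pow_zero, one_mul]

theorem cellMoment_succ (j x : ℕ) :
    ((x : ℝ) + 1) * cellMoment π j (x + 1) = cellMoment π (j + 1) x := by
  simp only [cellMoment, ← integral_const_mul]
  refine integral_congr_ae (Filter.Eventually.of_forall fun θ => ?_)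
  simp only [poissonWeight, Nat.factorial_succ]
  push_cast
  field_simp
  ring

theorem ofReal_cellMoment (j x : ℕ) :
    ENNReal.ofReal (cellMoment π j x) = ∫⁻ θ, ENNReal.ofReal ((θ : ℝ) ^ j)
      * ENNReal.ofReal (poissonWeight x θ) ∂(π : Measure ℝ≥0) := by
  rw [cellMoment, ofReal_integral_eq_lintegral_ofReal (integrable_pow_mul_poissonWeight π j x)
    (Filter.Eventually.of_forall fun θ => mul_nonneg (by positivity) (poissonWeight_nonneg _ _))]
  exact lintegral_congr fun θ => ENNReal.ofReal_mul (by positivity)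

/-- Handles cells of probability zero, where `bayes` takes the value `0 / 0 = 0`. -/
theorem cellMoment_eq_zero_of_le {i j x : ℕ} (hij : i ≤ j) (h : cellMoment π i x = 0) :
    cellMoment π j x = 0 := by
  rw [cellMoment, integral_eq_zero_iff_of_nonneg
    (fun θ => mul_nonneg (by positivity) (poissonWeight_nonneg _ _))
    (integrable_pow_mul_poissonWeight π i x)] at h
  rw [cellMoment, integral_eq_zero_of_ae]
  filter_upwards [h] with θ hθ
  obtain ⟨l, rfl⟩ := Nat.exists_eq_add_of_le hij
  rw [pow_add, mul_right_comm, hθ]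
  simp

theorem obsLaw_singleton (x : ℕ) : obsLaw π {x} = ENNReal.ofReal (cellMoment π 0 x) := by
  rw [obsLaw, Measure.map_apply measurable_snd (measurableSet_singleton x),
    ← lintegral_indicator_one (measurable_snd (measurableSet_singleton x)),
    lintegral_jointLaw π (measurable_one.indicator (measurable_snd (measurableSet_singleton x))),
    ofReal_cellMoment, tsum_eq_single x]
  · refine lintegral_congr fun θ => ?_
    simp
  · intro y hy
    simp [Set.indicator, hy]

theorem obsLaw_real_singleton (x : ℕ) : (obsLaw π).real {x} = cellMoment π 0 x := by
  rw [measureReal_def, obsLaw_singleton, ENNReal.toReal_ofReal (cellMoment_nonneg π 0 x)]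

theorem bayes_nonneg (k x : ℕ) : 0 ≤ bayes k π x :=
  div_nonneg (cellMoment_nonneg π k x) (cellMoment_nonneg π 0 x)

theorem bayes_mul_cellMoment_zero (k x : ℕ) : bayes k π x * cellMoment π 0 x = cellMoment π k x := by
  by_cases h : cellMoment π 0 x = 0
  · rw [h, mul_zero, cellMoment_eq_zero_of_le π (Nat.zero_le k) h]
  · exact div_mul_cancel₀ _ h

theorem integral_sq_sub_mul_poissonWeight (k x : ℕ) (s : ℝ) :
    Integrable (fun θ : ℝ≥0 => (s - (θ : ℝ) ^ k) ^ 2 * poissonWeight x θ) (π : Measure ℝ≥0) ∧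
    ∫ θ, (s - (θ : ℝ) ^ k) ^ 2 * poissonWeight x θ ∂(π : Measure ℝ≥0)
      = s ^ 2 * cellMoment π 0 x - 2 * s * cellMoment π k x + cellMoment π (2 * k) x := by
  have h0 := (integrable_pow_mul_poissonWeight π 0 x).const_mul (s ^ 2)
  have h1 := (integrable_pow_mul_poissonWeight π k x).const_mul (2 * s)
  have h2 := integrable_pow_mul_poissonWeight π (2 * k) x
  have e : (fun θ : ℝ≥0 => (s - (θ : ℝ) ^ k) ^ 2 * poissonWeight x θ)
      = fun θ : ℝ≥0 => s ^ 2 * ((θ : ℝ) ^ 0 * poissonWeight x θ)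
        - 2 * s * ((θ : ℝ) ^ k * poissonWeight x θ) + (θ : ℝ) ^ (2 * k) * poissonWeight x θ := by
    funext θ
    ring
  rw [e]
  refine ⟨(h0.sub h1).add h2, ?_⟩
  rw [integral_add (by exact h0.sub h1) h2, integral_sub h0 h1, integral_const_mul,
    integral_const_mul]
  rfl

/-- The posterior variance is nonnegative. -/
theorem bayes_sq_mul_cellMoment_le (k x : ℕ) :
    bayes k π x ^ 2 * cellMoment π 0 x ≤ cellMoment π (2 * k) x := by
  have h := (integral_sq_sub_mul_poissonWeight π k x (bayes k π x)).2
  have h0 : 0 ≤ ∫ θ, (bayes k π x - (θ : ℝ) ^ k) ^ 2 * poissonWeight x θ ∂(π : Measure ℝ≥0) :=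
    integral_nonneg fun θ => mul_nonneg (sq_nonneg _) (poissonWeight_nonneg _ _)
  rw [← bayes_mul_cellMoment_zero π k x] at h
  nlinarith

/-- Chebyshev's association inequality: with `r ^ k = bayes k π x`, the product `(θ ^ k - r ^ k)(θ -
r)` is nonnegative, so `θ ^ k` and `θ` are positively correlated under the posterior. Moving from
`x` to `x + 1` reweights that posterior by `θ`. -/
theorem bayes_le_bayes_succ {k : ℕ} (hk : 1 ≤ k) (x : ℕ) : bayes k π x ≤ bayes k π (x + 1) := by
  obtain ⟨r, hr0, hr⟩ : ∃ r : ℝ, 0 ≤ r ∧ r ^ k = bayes k π x :=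
    ⟨bayes k π x ^ (1 / (k : ℝ)), Real.rpow_nonneg (bayes_nonneg π k x) _, by
      rw [one_div]
      exact Real.rpow_inv_natCast_pow (bayes_nonneg π k x) (by omega)⟩
  have h0 := (integrable_pow_mul_poissonWeight π 0 x).const_mul (r ^ (k + 1))
  have h1 := (integrable_pow_mul_poissonWeight π 1 x).const_mul (r ^ k)
  have hk' := (integrable_pow_mul_poissonWeight π k x).const_mul r
  have hk1 := integrable_pow_mul_poissonWeight π (k + 1) x
  have e : ∫ θ, ((θ : ℝ) ^ k - r ^ k) * ((θ : ℝ) - r) * poissonWeight x θ ∂(π : Measure ℝ≥0)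
      = cellMoment π (k + 1) x - r ^ k * cellMoment π 1 x - r * cellMoment π k x
        + r ^ (k + 1) * cellMoment π 0 x := by
    have e' : (fun θ : ℝ≥0 => ((θ : ℝ) ^ k - r ^ k) * ((θ : ℝ) - r) * poissonWeight x θ)
        = fun θ : ℝ≥0 => (θ : ℝ) ^ (k + 1) * poissonWeight x θ
          - r ^ k * ((θ : ℝ) ^ 1 * poissonWeight x θ) - r * ((θ : ℝ) ^ k * poissonWeight x θ)
          + r ^ (k + 1) * ((θ : ℝ) ^ 0 * poissonWeight x θ) := by
      funext θ
      ring
    rw [e', integral_add (by exact (hk1.sub h1).sub hk') h0, integral_sub (by exact hk1.sub h1) hk',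
      integral_sub hk1 h1, integral_const_mul, integral_const_mul, integral_const_mul]
    rfl
  have hpos : 0 ≤ ∫ θ, ((θ : ℝ) ^ k - r ^ k) * ((θ : ℝ) - r) * poissonWeight x θ
      ∂(π : Measure ℝ≥0) := by
    refine integral_nonneg fun θ => mul_nonneg ?_ (poissonWeight_nonneg _ _)
    rcases le_total r (θ : ℝ) with h | h
    · exact mul_nonneg (sub_nonneg.2 (pow_le_pow_left₀ hr0 h k)) (sub_nonneg.2 h)
    · exact mul_nonneg_of_nonpos_of_nonpos (sub_nonpos.2 (pow_le_pow_left₀ θ.2 h k))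
        (sub_nonpos.2 h)
  have key : bayes k π x * cellMoment π 1 x ≤ cellMoment π (k + 1) x := by
    rw [e, ← bayes_mul_cellMoment_zero π k x, pow_succ, hr] at hpos
    linarith
  rw [← zero_add 1, ← cellMoment_succ, ← cellMoment_succ, mul_left_comm,
    mul_le_mul_iff_right₀ (by positivity)] at key
  rcases (cellMoment_nonneg π 0 (x + 1)).eq_or_lt with h | h
  -- If `x + 1` has probability zero, the first moment in cell `x` vanishes, hence so does the
  -- `k`-th, since `k ≥ 1`.
  · have h1 : cellMoment π 1 x = 0 := by rw [← zero_add 1, ← cellMoment_succ, ← h, mul_zero]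
    rw [bayes, cellMoment_eq_zero_of_le π hk h1, zero_div]
    exact bayes_nonneg π k (x + 1)
  · rw [bayes.eq_1 k π (x + 1), le_div_iff₀ h]
    simpa using key

theorem bayes_mem_monotoneClass {k : ℕ} (hk : 1 ≤ k) : bayes k π ∈ monotoneClass :=
  ⟨bayes_nonneg π k, bayes_le_bayes_succ π hk⟩

/-- Robbins' formula; it supplies the hypothesis `c * P {a} = t * P {b}` of the exchange lemmas with
`a = x + k` and `b = x`. -/
theorem descFactorial_mul_obsLaw (k x : ℕ) :
    ((x + k).descFactorial k : ℝ) * (obsLaw π).real {x + k}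
      = bayes k π x * (obsLaw π).real {x} := by
  rw [obsLaw_real_singleton, obsLaw_real_singleton, bayes_mul_cellMoment_zero,
    ← cellMoment_eq_descFactorial_mul]

/-! ### Reduction of the regret to the training error -/

/-- The mean squared error decomposes into the error of the Bayes estimator and the distance
to it. -/
theorem lintegral_sq_error_eq (k : ℕ) (s : ℕ → ℝ) :
    ∫⁻ p, ENNReal.ofReal ((s p.2 - (p.1 : ℝ) ^ k) ^ 2) ∂(jointLaw π)
      = ∫⁻ p, ENNReal.ofReal ((bayes k π p.2 - (p.1 : ℝ) ^ k) ^ 2) ∂(jointLaw π)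
        + ∫⁻ p, ENNReal.ofReal ((s p.2 - bayes k π p.2) ^ 2) ∂(jointLaw π) := by
  have hm : ∀ s : ℕ → ℝ, Measurable fun p : ℝ≥0 × ℕ => s p.2 := fun s =>
    Measurable.of_discrete.comp measurable_snd
  have h1 := hm s
  have h2 := hm (bayes k π)
  rw [lintegral_jointLaw π (by fun_prop), lintegral_jointLaw π (by fun_prop),
    lintegral_jointLaw π (by fun_prop), ← ENNReal.tsum_add]
  refine tsum_congr fun x => ?_
  dsimp only
  have hcell : ∀ a : ℝ, ∫⁻ θ, ENNReal.ofReal ((a - (θ : ℝ) ^ k) ^ 2)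
      * ENNReal.ofReal (poissonWeight x θ) ∂(π : Measure ℝ≥0)
      = ENNReal.ofReal (a ^ 2 * cellMoment π 0 x - 2 * a * cellMoment π k x
        + cellMoment π (2 * k) x) := by
    intro a
    have h := integral_sq_sub_mul_poissonWeight π k x a
    rw [← h.2, ofReal_integral_eq_lintegral_ofReal h.1 (Filter.Eventually.of_forall fun θ =>
      mul_nonneg (sq_nonneg _) (poissonWeight_nonneg _ _))]
    exact lintegral_congr fun θ => (ENNReal.ofReal_mul (sq_nonneg _)).symm
  have hw := ofReal_cellMoment π 0 x
  simp only [pow_zero, ENNReal.ofReal_one, one_mul] at hw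
  rw [hcell, hcell, lintegral_const_mul _ (by fun_prop), ← hw, ← ENNReal.ofReal_mul (sq_nonneg _),
    ← ENNReal.ofReal_add]
  · congr 1
    rw [← bayes_mul_cellMoment_zero π k x]
    ring
  · rw [← bayes_mul_cellMoment_zero π k x]
    have := bayes_sq_mul_cellMoment_le π k x
    linarith
  · exact mul_nonneg (sq_nonneg _) (cellMoment_nonneg π 0 x)

theorem lintegral_bayes_le_mmse (k : ℕ) :
    ∫⁻ p, ENNReal.ofReal ((bayes k π p.2 - (p.1 : ℝ) ^ k) ^ 2) ∂(jointLaw π) ≤ mmse k π :=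
  le_iInf fun s => by
    rw [lintegral_sq_error_eq π k s]
    exact le_self_add

theorem lintegral_pi_eq_insertNth {α : Type*} [MeasurableSpace α] (μ : Measure α)
    [IsProbabilityMeasure μ] {m : ℕ} (i : Fin (m + 1)) {f : (Fin (m + 1) → α) → ℝ≥0∞}
    (hf : Measurable f) :
    ∫⁻ ω, f ω ∂(Measure.pi fun _ => μ)
      = ∫⁻ r, ∫⁻ p, f (i.insertNth p r) ∂μ ∂(Measure.pi fun _ : Fin m => μ) := by
  have h := (measurePreserving_piFinSuccAbove (fun _ : Fin (m + 1) => μ) i).symm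
  rw [← h.lintegral_comp hf]
  exact lintegral_prod_symm _ (hf.comp h.measurable).aemeasurable

theorem map_snd_sampleLaw (n : ℕ) :
    (sampleLaw π n).map (fun ω i => (ω i).2) = Measure.pi fun _ => obsLaw π := by
  unfold sampleLaw obsLaw
  have : IsProbabilityMeasure ((jointLaw π).map Prod.snd) :=
    inferInstanceAs (IsProbabilityMeasure (obsLaw π))
  exact Measure.pi_map_pi fun _ => measurable_snd.aemeasurable

/-- Given the other pairs, `T` is a function of the `l`-th observation alone, so the decomposition
for one pair applies; its Bayes term does not depend on the other pairs. -/
theorem lintegral_sample_sq_error_eq (k : ℕ) {m : ℕ} (l : Fin (m + 1))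
    (T : (Fin (m + 1) → ℕ) → ℝ) :
    ∫⁻ ω, ENNReal.ofReal ((T (fun i => (ω i).2) - ((ω l).1 : ℝ) ^ k) ^ 2)
        ∂(Measure.pi fun _ => jointLaw π)
      = ∫⁻ p, ENNReal.ofReal ((bayes k π p.2 - (p.1 : ℝ) ^ k) ^ 2) ∂(jointLaw π)
        + ∫⁻ ω, ENNReal.ofReal ((T (fun i => (ω i).2) - bayes k π (ω l).2) ^ 2)
          ∂(Measure.pi fun _ => jointLaw π) := by
  have hX : Measurable fun (ω : Fin (m + 1) → ℝ≥0 × ℕ) i => (ω i).2 := by fun_prop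
  have hT : Measurable fun ω : Fin (m + 1) → ℝ≥0 × ℕ => T (fun i => (ω i).2) :=
    (Measurable.of_discrete (f := T)).comp hX
  have hb : Measurable fun ω : Fin (m + 1) → ℝ≥0 × ℕ => bayes k π (ω l).2 :=
    (Measurable.of_discrete (f := bayes k π)).comp (measurable_snd.comp (measurable_pi_apply l))
  have hθ : Measurable fun ω : Fin (m + 1) → ℝ≥0 × ℕ => (((ω l).1 : ℝ≥0) : ℝ) :=
    measurable_coe_nnreal_real.comp (measurable_fst.comp (measurable_pi_apply l))
  rw [lintegral_pi_eq_insertNth (jointLaw π) l (by fun_prop),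
    lintegral_pi_eq_insertNth (jointLaw π) l (by fun_prop)]
  have hins : ∀ (p : ℝ≥0 × ℕ) (r : Fin m → ℝ≥0 × ℕ),
      (fun i => (Fin.insertNth (α := fun _ => ℝ≥0 × ℕ) l p r i).2)
        = Fin.insertNth (α := fun _ => ℕ) l p.2 (fun j => (r j).2) := by
    intro p r
    funext i
    rcases Fin.eq_self_or_eq_succAbove l i with h | ⟨j, h⟩
    · rw [h, Fin.insertNth_apply_same, Fin.insertNth_apply_same]
    · rw [h, Fin.insertNth_apply_succAbove, Fin.insertNth_apply_succAbove]
  simp_rw [hins, Fin.insertNth_apply_same]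
  have h : ∀ r : Fin m → ℝ≥0 × ℕ, _ := fun r => lintegral_sq_error_eq π k
    fun x => T (Fin.insertNth (α := fun _ => ℕ) l x fun j => (r j).2)
  simp_rw [h]
  rw [lintegral_add_left measurable_const, lintegral_const, measure_univ, mul_one]

theorem lastMSE_eq (k n : ℕ) (hn : 0 < n) (T : (Fin n → ℕ) → Fin n → ℝ) :
    lastMSE k n hn π T
      = ∫⁻ p, ENNReal.ofReal ((bayes k π p.2 - (p.1 : ℝ) ^ k) ^ 2) ∂(jointLaw π)
        + ∫⁻ x, ENNReal.ofReal ((T x (lastIndex n hn) - bayes k π (x (lastIndex n hn))) ^ 2)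
          ∂(Measure.pi fun _ => obsLaw π) := by
  have hX : Measurable fun (ω : Fin n → ℝ≥0 × ℕ) i => (ω i).2 := by fun_prop
  rw [← map_snd_sampleLaw, lintegral_map Measurable.of_discrete hX]
  obtain ⟨m, rfl⟩ := Nat.exists_eq_succ_of_ne_zero hn.ne'
  exact lintegral_sample_sq_error_eq π k (lastIndex (m + 1) hn) fun x => T x (lastIndex (m + 1) hn)

theorem lintegral_comp_perm {n : ℕ} (P : Measure ℕ) [IsProbabilityMeasure P]
    (σ : Equiv.Perm (Fin n)) (G : (Fin n → ℕ) → ℝ≥0∞) :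
    ∫⁻ x, G (x ∘ σ) ∂(Measure.pi fun _ => P) = ∫⁻ x, G x ∂(Measure.pi fun _ => P) := by
  rw [lintegral_countable', lintegral_countable',
    ← Equiv.tsum_eq (σ.symm.arrowCongr (Equiv.refl ℕ)) fun x => G x * _]
  refine tsum_congr fun x => ?_
  have hx : σ.symm.arrowCongr (Equiv.refl ℕ) x = x ∘ σ := rfl
  rw [hx, Measure.pi_singleton, Measure.pi_singleton]
  congr 1
  exact (Equiv.prod_comp σ fun i => P {x i}).symm

/-- Equivariance and the i.i.d. sample give all coordinates the same expected error. -/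
theorem mul_lintegral_last_eq {F : Set (ℕ → ℝ)} (hF : Convex ℝ F) {k n : ℕ} (hn : 0 < n)
    {T : (Fin n → ℕ) → Fin n → ℝ} (hT : IsERM F k n T) (P : Measure ℕ) [IsProbabilityMeasure P]
    (s : ℕ → ℝ) (l : Fin n) :
    n * ∫⁻ x, ENNReal.ofReal ((T x l - s (x l)) ^ 2) ∂(Measure.pi fun _ => P)
      = ∫⁻ x, ENNReal.ofReal (∑ i, (T x i - s (x i)) ^ 2) ∂(Measure.pi fun _ => P) := by
  simp_rw [ENNReal.ofReal_sum_of_nonneg fun i _ => sq_nonneg _]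
  rw [lintegral_finsetSum _ fun i _ => Measurable.of_discrete]
  have h : ∀ i : Fin n, ∫⁻ x, ENNReal.ofReal ((T x i - s (x i)) ^ 2) ∂(Measure.pi fun _ => P)
      = ∫⁻ x, ENNReal.ofReal ((T x l - s (x l)) ^ 2) ∂(Measure.pi fun _ => P) := by
    intro i
    rw [← lintegral_comp_perm P (Equiv.swap i l)
      fun x => ENNReal.ofReal ((T x l - s (x l)) ^ 2)]
    refine lintegral_congr fun x => ?_
    rw [hT.comp_perm hF hn, Function.comp_apply, Equiv.swap_apply_right]
  rw [Finset.sum_congr rfl fun i _ => h i]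
  simp

/-- Bounding the error by `b` plus the minimum and only then subtracting avoids any case distinction
on whether the minimum is finite. -/
theorem individualRegret_le_of_lastMSE_le {k n : ℕ} {hn : 0 < n} {T : (Fin n → ℕ) → Fin n → ℝ}
    {b : ℝ} (hb : 0 ≤ b)
    (h : ∫⁻ x, ENNReal.ofReal ((T x (lastIndex n hn) - bayes k π (x (lastIndex n hn))) ^ 2)
      ∂(Measure.pi fun _ => obsLaw π) ≤ ENNReal.ofReal b) :
    individualRegret k n hn π T ≤ (b : EReal) := by
  unfold individualRegret
  refine EReal.sub_le_of_le_add ?_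
  have h1 : lastMSE k n hn π T ≤ ENNReal.ofReal b + mmse k π := by
    rw [lastMSE_eq, add_comm]
    exact add_le_add h (lintegral_bayes_le_mmse π k)
  have h2 := EReal.coe_ennreal_le_coe_ennreal_iff.2 h1
  rwa [EReal.coe_ennreal_add, EReal.coe_ennreal_ofReal, max_eq_left hb] at h2

theorem individualRegret_le_of_lintegral_sum_le {F : Set (ℕ → ℝ)} (hF : Convex ℝ F) {k n : ℕ}
    {hn : 0 < n} {T : (Fin n → ℕ) → Fin n → ℝ} (hT : IsERM F k n T) {b : ℝ} (hb : 0 ≤ b)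
    (h : ∫⁻ x, ENNReal.ofReal (∑ i, (T x i - bayes k π (x i)) ^ 2)
      ∂(Measure.pi fun _ => obsLaw π) ≤ ENNReal.ofReal b) :
    individualRegret k n hn π T ≤ ((b / n : ℝ) : EReal) := by
  refine individualRegret_le_of_lastMSE_le π (by positivity) ?_
  rw [← mul_lintegral_last_eq hF hn hT (obsLaw π) (bayes k π) (lastIndex n hn)] at h
  have hn' : (0 : ℝ) < n := by exact_mod_cast hn
  rw [ENNReal.ofReal_div_of_pos hn', ENNReal.ofReal_natCast,
    ENNReal.le_div_iff_mul_le (Or.inl (by simpa using hn.ne')) (Or.inl (by simp)), mul_comm]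
  exact h

/-- The training error of an empirical risk minimizer, bounded cell by cell. -/
theorem lintegral_sum_sq_le {F : Set (ℕ → ℝ)} (hF : Convex ℝ F) {k n : ℕ} (hk : 1 ≤ k)
    (hn : 0 < n) {T : (Fin n → ℕ) → Fin n → ℝ} {t : (Fin n → ℕ) → ℕ → ℝ}
    (htF : ∀ x, t x ∈ F) (ht : ∀ x, IsMinOn (empiricalRisk k x) F (t x))
    (hT : ∀ x, T x = fun i => t x (x i)) (hb : bayes k π ∈ F) :
    ∫⁻ x, ENNReal.ofReal (∑ i, (T x i - bayes k π (x i)) ^ 2) ∂(Measure.pi fun _ => obsLaw π)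
      ≤ ∑' y, ENNReal.ofReal (3 * bayes k π y ^ 2
          + 2 * (((y + k).descFactorial k : ℝ) * bayes k π y)) * min 1 (n * obsLaw π {y})
        + 2 * ∫⁻ x, ∑' y, ENNReal.ofReal (if cellCount y x = 0 then
          (y + k).descFactorial k * cellCount (y + k) x * t x y else 0)
          ∂(Measure.pi fun _ => obsLaw π) := by
  calc ∫⁻ x, ENNReal.ofReal (∑ i, (T x i - bayes k π (x i)) ^ 2) ∂(Measure.pi fun _ => obsLaw π)
      ≤ ∫⁻ x, (∑' y, ENNReal.ofReal ((cellCount y x * bayes k π y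
          - (y + k).descFactorial k * cellCount (y + k) x) ^ 2 / cellCount y x)
        + 2 * ∑' y, ENNReal.ofReal (if cellCount y x = 0 then
          (y + k).descFactorial k * cellCount (y + k) x * t x y else 0))
          ∂(Measure.pi fun _ => obsLaw π) := by
        refine lintegral_mono fun x => ?_
        -- The cutoff depends on the sample, so the finite sum over cells is enlarged to all of `ℕ`
        -- before integrating.
        have hR : ∀ i, x i < (∑ j, x j) + 1 := fun i => Nat.lt_succ_of_le
          (Finset.single_le_sum (f := x) (fun j _ => Nat.zero_le _) (Finset.mem_univ i))
        have h := sum_sq_sub_le_of_isMinOn hF hn hR (htF x) (ht x) hb (bayes_nonneg π k)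
        rw [hT]
        refine (ENNReal.ofReal_le_ofReal h).trans ?_
        rw [← ENNReal.tsum_mul_left, ← ENNReal.tsum_add]
        refine le_trans ?_ (ENNReal.sum_le_tsum (Finset.range (∑ j, x j + 1)))
        refine (Finset.le_sum_of_subadditive ENNReal.ofReal ENNReal.ofReal_zero.le
          (fun _ _ => ENNReal.ofReal_add_le) _ _).trans (Finset.sum_le_sum fun y _ => ?_)
        refine ENNReal.ofReal_add_le.trans ?_
        rw [ENNReal.ofReal_mul zero_le_two, ENNReal.ofReal_ofNat]
    _ = ∑' y, ∫⁻ x, ENNReal.ofReal ((cellCount y x * bayes k π y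
          - (y + k).descFactorial k * cellCount (y + k) x) ^ 2 / cellCount y x)
          ∂(Measure.pi fun _ => obsLaw π)
        + 2 * ∫⁻ x, ∑' y, ENNReal.ofReal (if cellCount y x = 0 then
          (y + k).descFactorial k * cellCount (y + k) x * t x y else 0)
          ∂(Measure.pi fun _ => obsLaw π) := by
        rw [lintegral_add_left Measurable.of_discrete,
          lintegral_tsum fun y => Measurable.of_discrete.aemeasurable,
          lintegral_const_mul _ Measurable.of_discrete]
    _ ≤ _ := by
        gcongr with y
        exact lintegral_cell_sq_div_le (obsLaw π) (by omega) (Nat.cast_nonneg _)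
          (bayes_nonneg π k y) (descFactorial_mul_obsLaw π k y)

end

/-! ### Bounded priors -/

theorem ae_le_of_mem_boundedPriors {π : ProbabilityMeasure ℝ≥0} {h : ℝ≥0}
    (hπ : π ∈ boundedPriors h) : ∀ᵐ θ ∂(π : Measure ℝ≥0), θ ≤ h := by
  have h0 : (π : Measure ℝ≥0) (Set.Icc 0 h)ᶜ = 0 :=
    (prob_compl_eq_zero_iff measurableSet_Icc).2 hπ
  filter_upwards [compl_mem_ae_iff.2 h0] with θ hθ
  rw [compl_compl] at hθ
  exact hθ.2

theorem bayes_le_of_mem_boundedPriors {π : ProbabilityMeasure ℝ≥0} {h : ℝ≥0}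
    (hπ : π ∈ boundedPriors h) (k x : ℕ) : bayes k π x ≤ (h : ℝ) ^ k := by
  refine div_le_of_le_mul₀ (cellMoment_nonneg π 0 x) (by positivity) ?_
  unfold cellMoment
  rw [← integral_const_mul]
  refine integral_mono_ae (integrable_pow_mul_poissonWeight π k x)
    ((integrable_pow_mul_poissonWeight π 0 x).const_mul _) ?_
  filter_upwards [ae_le_of_mem_boundedPriors hπ] with θ hθ
  rw [pow_zero, one_mul]
  exact mul_le_mul_of_nonneg_right (pow_le_pow_left₀ θ.2 (by exact_mod_cast hθ) k)
    (poissonWeight_nonneg x θ)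

theorem obsLaw_singleton_le_of_mem_boundedPriors {π : ProbabilityMeasure ℝ≥0} {h : ℝ≥0}
    (hπ : π ∈ boundedPriors h) (x : ℕ) :
    obsLaw π {x} ≤ ENNReal.ofReal ((h : ℝ) ^ x / x.factorial) := by
  rw [obsLaw_singleton]
  refine ENNReal.ofReal_le_ofReal ?_
  unfold cellMoment
  have hc : ∫ _, (h : ℝ) ^ x / x.factorial ∂(π : Measure ℝ≥0) = (h : ℝ) ^ x / x.factorial := by
    simp
  rw [← hc]
  refine integral_mono_ae (integrable_pow_mul_poissonWeight π 0 x) (integrable_const _) ?_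
  filter_upwards [ae_le_of_mem_boundedPriors hπ] with θ hθ
  have hθ' : (θ : ℝ) ≤ h := by exact_mod_cast hθ
  have hθ0 : (0 : ℝ) ≤ θ := θ.2
  rw [pow_zero, one_mul, poissonWeight]
  gcongr
  refine (mul_le_of_le_one_left (by positivity) (Real.exp_le_one_iff.2 (by linarith))).trans ?_
  exact pow_le_pow_left₀ hθ0 hθ' x

theorem bayes_mem_clippedMonotoneClass {π : ProbabilityMeasure ℝ≥0} {h : ℝ≥0}
    (hπ : π ∈ boundedPriors h) {k : ℕ} (hk : 1 ≤ k) :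
    bayes k π ∈ clippedMonotoneClass 0 ((h : ℝ) ^ k) :=
  ⟨bayes_mem_monotoneClass π hk,
    fun x => ⟨bayes_nonneg π k x, bayes_le_of_mem_boundedPriors hπ k x⟩⟩

/-- Clipping bounds the estimator on empty cells by `h ^ k`, which adds `2` to the coefficient `3`
of a nonempty cell. -/
theorem lintegral_sum_sq_le_of_mem_boundedPriors {π : ProbabilityMeasure ℝ≥0} {h : ℝ≥0}
    (hπ : π ∈ boundedPriors h) {k n : ℕ} (hk : 1 ≤ k) (hn : 0 < n)
    {T : (Fin n → ℕ) → Fin n → ℝ} (hT : IsERM (clippedMonotoneClass 0 ((h : ℝ) ^ k)) k n T) :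
    ∫⁻ x, ENNReal.ofReal (∑ i, (T x i - bayes k π (x i)) ^ 2) ∂(Measure.pi fun _ => obsLaw π)
      ≤ ∑' y, ENNReal.ofReal (5 * ((h : ℝ) ^ k) ^ 2
          + 2 * (((y + k).descFactorial k : ℝ) * (h : ℝ) ^ k)) * min 1 (n * obsLaw π {y}) := by
  have hT' := hT
  choose t htF ht hTt using hT'
  set H : ℝ := (h : ℝ) ^ k
  have hH : 0 ≤ H := by positivity
  refine (lintegral_sum_sq_le π (convex_clippedMonotoneClass 0 H) hk hn htF ht hTt
    (bayes_mem_clippedMonotoneClass hπ hk)).trans ?_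
  have h2 : ∫⁻ x, ∑' y, ENNReal.ofReal (if cellCount y x = 0 then
          (y + k).descFactorial k * cellCount (y + k) x * t x y else 0)
          ∂(Measure.pi fun _ => obsLaw π)
      ≤ ∑' y, ENNReal.ofReal (H * bayes k π y) * min 1 (n * obsLaw π {y}) := by
    rw [lintegral_tsum fun y => Measurable.of_discrete.aemeasurable]
    refine ENNReal.tsum_le_tsum fun y => ?_
    rw [ENNReal.ofReal_mul hH, mul_assoc]
    refine le_trans ?_ (mul_le_mul_right (lintegral_cellCount_empty_le (obsLaw π) (by omega)
      (Nat.cast_nonneg _) (bayes_nonneg π k y) (descFactorial_mul_obsLaw π k y)) _)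
    rw [← lintegral_const_mul _ Measurable.of_discrete]
    refine lintegral_mono fun x => ?_
    rw [← ENNReal.ofReal_mul hH]
    refine ENNReal.ofReal_le_ofReal ?_
    split_ifs
    · rw [mul_comm H]
      exact mul_le_mul_of_nonneg_left ((htF x).2 y).2 (by positivity)
    · simp
  refine (add_le_add_right (mul_le_mul_right h2 2) _).trans ?_
  rw [← ENNReal.tsum_mul_left, ← ENNReal.tsum_add]
  refine ENNReal.tsum_le_tsum fun y => ?_
  have hb0 := bayes_nonneg π k y
  have hb1 : bayes k π y ≤ H := bayes_le_of_mem_boundedPriors hπ k y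
  have hc : (0 : ℝ) ≤ (y + k).descFactorial k := Nat.cast_nonneg _
  rw [← mul_assoc 2 (ENNReal.ofReal _), ← add_mul]
  refine mul_le_mul_left ?_ _
  rw [← ENNReal.ofReal_ofNat 2, ← ENNReal.ofReal_mul zero_le_two, ← ENNReal.ofReal_add
    (by positivity) (by positivity)]
  refine ENNReal.ofReal_le_ofReal ?_
  nlinarith [mul_le_mul_of_nonneg_left hb1 hc, mul_le_mul_of_nonneg_left hb1 hH,
    mul_le_mul hb1 hb1 hb0 hH]

/-- Splitting a sum of truncated expected counts at a level `M`. -/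
theorem tsum_mul_min_le (f p : ℕ → ℝ≥0∞) (M : ℕ) (n : ℝ≥0∞) :
    ∑' y, f y * min 1 (n * p y)
      ≤ ∑ y ∈ Finset.range M, f y + n * ∑' y, if M ≤ y then f y * p y else 0 := by
  have hs : ∑ y ∈ Finset.range M, f y = ∑' y, if y < M then f y else 0 := by
    rw [tsum_eq_sum (s := Finset.range M) fun y hy => if_neg (by simpa using hy)]
    exact Finset.sum_congr rfl fun y hy => (if_pos (Finset.mem_range.1 hy)).symm
  rw [hs, ← ENNReal.tsum_mul_left, ← ENNReal.tsum_add]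
  refine ENNReal.tsum_le_tsum fun y => ?_
  by_cases hy : y < M
  · rw [if_pos hy, if_neg (by omega), mul_zero, add_zero]
    exact mul_le_of_le_one_right' (min_le_left _ _)
  · rw [if_neg hy, if_pos (by omega), zero_add, mul_left_comm]
    exact mul_le_mul_right (min_le_right _ _) _

/-- Chernoff bound: for `y ≥ M` the factor `L ^ y / L ^ M` is at least `1`. -/
theorem tsum_pow_div_factorial_tail_le {z L : ℝ} (hz : 0 ≤ z) (hL : 1 ≤ L) (M : ℕ) :
    ∑' y : ℕ, (if M ≤ y then ENNReal.ofReal (z ^ y / y.factorial) else 0)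
      ≤ ENNReal.ofReal (Real.exp (L * z) / L ^ M) := by
  have hL0 : 0 < L := by linarith
  have hs : HasSum (fun y : ℕ => (L * z) ^ y / y.factorial) (Real.exp (L * z)) := by
    rw [Real.exp_eq_exp_ℝ]
    exact NormedSpace.expSeries_div_hasSum_exp (L * z)
  have hs' := hs.div_const (L ^ M)
  rw [← hs'.tsum_eq, ENNReal.ofReal_tsum_of_nonneg (fun y => by positivity) hs'.summable]
  refine ENNReal.tsum_le_tsum fun y => ?_
  split_ifs with hy
  · refine ENNReal.ofReal_le_ofReal ?_
    rw [le_div_iff₀ (by positivity), mul_pow, mul_comm (L ^ y), mul_div_right_comm]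
    exact mul_le_mul_of_nonneg_left (pow_le_pow_right₀ hL hy) (by positivity)
  · simp

theorem descFactorial_add_le_two_pow (y k : ℕ) :
    (y + k).descFactorial k ≤ 2 ^ k * k.factorial * 2 ^ y := by
  rw [Nat.descFactorial_eq_factorial_mul_choose]
  have h := Nat.choose_le_two_pow (y + k) k
  calc k.factorial * (y + k).choose k ≤ k.factorial * 2 ^ (y + k) := Nat.mul_le_mul_left _ h
    _ = 2 ^ k * k.factorial * 2 ^ y := by rw [pow_add]; ring

/-! ### Elementary inequalities for `log n / log log n` -/

theorem one_lt_log_of_three_le {n : ℕ} (hn : 3 ≤ n) : 1 < Real.log n := by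
  have hn' : (3 : ℝ) ≤ n := by exact_mod_cast hn
  rw [Real.lt_log_iff_exp_lt (by linarith)]
  linarith [Real.exp_one_lt_d9]

theorem one_le_log_div_log {u : ℝ} (hu : 1 < u) : 1 ≤ Real.log (u / Real.log u) := by
  have hv : 0 < Real.log u := Real.log_pos hu
  rw [Real.le_log_iff_exp_le (by positivity), le_div_iff₀ hv]
  have h := Real.log_le_sub_one_of_pos (show 0 < u / Real.exp 1 by positivity)
  rw [Real.log_div (by positivity) (by positivity), Real.log_exp, sub_le_sub_iff_right,
    le_div_iff₀ (by positivity)] at h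
  linarith

/-- Since `log (log u) ≤ (log u) / 2`, the logarithm of `u / log u` is at least `(log u) / 2`. With
`u = log n` this is `log n ≤ 2 L log L`. -/
theorem le_two_mul_div_log_mul_log {u : ℝ} (hu : 1 < u) :
    u ≤ 2 * (u / Real.log u) * Real.log (u / Real.log u) := by
  have hv : 0 < Real.log u := Real.log_pos hu
  have h1 : Real.log (Real.log u) ≤ Real.log u / 2 := by
    have h := Real.log_le_sub_one_of_pos (show 0 < Real.log u / 2 by positivity)
    rw [Real.log_div hv.ne' two_ne_zero] at h
    linarith [Real.log_two_lt_d9]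
  rw [Real.log_div (by positivity) hv.ne']
  calc u = 2 * (u / Real.log u) * (Real.log u / 2) := by field_simp
    _ ≤ _ := mul_le_mul_of_nonneg_left (by linarith) (by positivity)

/-- Cells below `M`, of order `L`, cost at most order `(M + k) ^ k` each, and `k ≤ 2L` keeps this at
order `L ^ k`. The cells above contribute a bounded amount by the Poisson tail. -/
theorem individualRegret_le_of_small_degree {π : ProbabilityMeasure ℝ≥0} {h : ℝ≥0}
    (hπ : π ∈ boundedPriors h) {k n : ℕ} (hk : 1 ≤ k) {hn : 0 < n}
    {T : (Fin n → ℕ) → Fin n → ℝ} (hT : IsERM (clippedMonotoneClass 0 ((h : ℝ) ^ k)) k n T)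
    {L : ℝ} (hL : 1 ≤ Real.log L) (hL0 : 1 ≤ L) (hnL : Real.log n ≤ 2 * L * Real.log L)
    (hkL : (k : ℝ) ≤ 2 * L) :
    individualRegret k n hn π T
      ≤ (((70 + 28 * (h : ℝ)) ^ (2 * k + 1) * L ^ (k + 1) / n : ℝ) : EReal) := by
  have hh : (0 : ℝ) ≤ h := h.2
  refine individualRegret_le_of_lintegral_sum_le π (convex_clippedMonotoneClass 0 _) hT
    (by positivity) ?_
  refine (lintegral_sum_sq_le_of_mem_boundedPriors hπ hk hn hT).trans ?_
  -- Chosen so that `n * exp (2hL) ≤ L ^ M`: the summand `2L` pays for `log n ≤ 2 L log L`, and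
  -- `2hL` for the exponential because `log L ≥ 1`.
  set M := ⌈(2 + 2 * (h : ℝ)) * L⌉₊ with hM
  set H : ℝ := (h : ℝ) ^ k with hH
  have hH0 : 0 ≤ H := by positivity
  have hM1 : (2 + 2 * (h : ℝ)) * L ≤ M := Nat.le_ceil _
  have hM2 : (M : ℝ) ≤ (3 + 2 * h) * L := by
    have := (Nat.ceil_lt_add_one (show 0 ≤ (2 + 2 * (h : ℝ)) * L by positivity)).le
    linarith
  refine (tsum_mul_min_le _ _ M n).trans ?_
  have hnexp : (n : ℝ) * (Real.exp (L * (2 * h)) / L ^ M) ≤ 1 := by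
    have hn' : (0 : ℝ) < n := by exact_mod_cast hn
    rw [← mul_div_assoc, div_le_one (by positivity), ← Real.exp_log hn', ← Real.exp_add,
      ← Real.exp_log (show 0 < L ^ M by positivity), Real.exp_le_exp, Real.log_pow]
    have h1 := mul_le_mul_of_nonneg_right hM1 (by linarith : 0 ≤ Real.log L)
    have h2 := mul_le_mul_of_nonneg_left hL (show 0 ≤ 2 * (h : ℝ) * L by positivity)
    linarith
  have hhead : ∑ y ∈ Finset.range M, ENNReal.ofReal (5 * H ^ 2
      + 2 * (((y + k).descFactorial k : ℝ) * H))
      ≤ ENNReal.ofReal (M * (5 * H ^ 2 + 2 * ((M + k : ℝ) ^ k * H))) := by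
    rw [ENNReal.ofReal_mul (Nat.cast_nonneg M), ENNReal.ofReal_natCast]
    refine (Finset.sum_le_card_nsmul _ _ _ fun y hy => ?_).trans (by rw [Finset.card_range,
      nsmul_eq_mul])
    refine ENNReal.ofReal_le_ofReal ?_
    have hc : ((y + k).descFactorial k : ℝ) ≤ (M + k : ℝ) ^ k := by
      refine (Nat.cast_le.2 (Nat.descFactorial_le_pow _ _)).trans ?_
      push_cast
      have : (y : ℝ) ≤ M := by exact_mod_cast (Finset.mem_range.1 hy).le
      gcongr
    gcongr
  have htail : (n : ℝ≥0∞) * ∑' y, (if M ≤ y then ENNReal.ofReal (5 * H ^ 2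
      + 2 * (((y + k).descFactorial k : ℝ) * H)) * obsLaw π {y} else 0)
      ≤ ENNReal.ofReal (5 * H ^ 2 + 2 * (2 ^ k * k.factorial * H)) := by
    calc _ ≤ (n : ℝ≥0∞) * ∑' y : ℕ, ENNReal.ofReal (5 * H ^ 2 + 2 * (2 ^ k * k.factorial * H))
          * (if M ≤ y then ENNReal.ofReal ((2 * (h : ℝ)) ^ y / y.factorial) else 0) := by
          refine mul_le_mul_right (ENNReal.tsum_le_tsum fun y => ?_) _
          split_ifs
          · refine (mul_le_mul_right (obsLaw_singleton_le_of_mem_boundedPriors hπ y) _).trans ?_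
            rw [← ENNReal.ofReal_mul (by positivity), ← ENNReal.ofReal_mul (by positivity)]
            refine ENNReal.ofReal_le_ofReal ?_
            have hc : ((y + k).descFactorial k : ℝ) ≤ 2 ^ k * k.factorial * 2 ^ y := by
              exact_mod_cast descFactorial_add_le_two_pow y k
            have h2 : (1 : ℝ) ≤ 2 ^ y := one_le_pow₀ one_le_two
            rw [mul_pow, mul_div_assoc,
              ← mul_assoc (5 * H ^ 2 + 2 * (2 ^ k * (k.factorial : ℝ) * H))]
            refine mul_le_mul_of_nonneg_right ?_ (show 0 ≤ (h : ℝ) ^ y / y.factorial by positivity)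
            nlinarith [mul_le_mul_of_nonneg_right hc hH0,
              mul_le_mul_of_nonneg_left h2 (sq_nonneg H)]
          · simp
      _ ≤ (n : ℝ≥0∞) * (ENNReal.ofReal (5 * H ^ 2 + 2 * (2 ^ k * k.factorial * H))
          * ENNReal.ofReal (Real.exp (L * (2 * h)) / L ^ M)) := by
          rw [ENNReal.tsum_mul_left]
          gcongr
          exact tsum_pow_div_factorial_tail_le (by positivity) hL0 M
      _ ≤ _ := by
          rw [mul_left_comm, ← ENNReal.ofReal_natCast n, ← ENNReal.ofReal_mul (Nat.cast_nonneg n)]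
          exact mul_le_of_le_one_right' (ENNReal.ofReal_le_one.2 hnexp)
  refine (add_le_add hhead htail).trans ?_
  rw [← ENNReal.ofReal_add (by positivity) (by positivity)]
  refine ENNReal.ofReal_le_ofReal ?_
  -- `M ≤ (3 + 2h)L` and `k ≤ 2L` give `M + k ≤ D L`. Head and tail then add up to `2 * (5 + 2) =
  -- 14` units, and `14 D = 70 + 28h`.
  set D : ℝ := 5 + 2 * h with hD
  have hD1 : 1 ≤ D := by linarith
  have hMD : (M : ℝ) ≤ D * L := hM2.trans (mul_le_mul_of_nonneg_right (by linarith) (by linarith))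
  have hMk : (M : ℝ) + k ≤ D * L := by rw [hD]; linarith
  have hHD : H ≤ D ^ k := pow_le_pow_left₀ hh (by linarith) k
  have hfac : (2 : ℝ) ^ k * k.factorial ≤ (D * L) ^ k := by
    have h1 : (k.factorial : ℝ) ≤ (k : ℝ) ^ k := by exact_mod_cast Nat.factorial_le_pow k
    calc (2 : ℝ) ^ k * k.factorial ≤ 2 ^ k * (k : ℝ) ^ k := by gcongr
      _ = (2 * k : ℝ) ^ k := (mul_pow _ _ _).symm
      _ ≤ (D * L) ^ k := by
          refine pow_le_pow_left₀ (by positivity) ?_ k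
          have := mul_nonneg hh (by linarith : 0 ≤ L)
          rw [hD]
          linarith
  have hpow : D ^ (2 * k + 1) * L ^ (k + 1) = D * L * ((D * L) ^ k * D ^ k) := by
    rw [mul_pow]
    ring
  have hDL : 1 ≤ D * L := one_le_mul_of_one_le_of_one_le hD1 hL0
  have hDk : (1 : ℝ) ≤ D ^ k := one_le_pow₀ hD1
  have hDDL : D ^ k ≤ (D * L) ^ k :=
    pow_le_pow_left₀ (by positivity) (le_mul_of_one_le_right (by positivity) hL0) k
  have hHH : H ^ 2 ≤ (D * L) ^ k * D ^ k := by
    rw [sq]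
    exact mul_le_mul (hHD.trans hDDL) hHD hH0 (by positivity)
  have hfH : 2 ^ k * k.factorial * H ≤ (D * L) ^ k * D ^ k :=
    mul_le_mul hfac hHD hH0 (by positivity)
  have hMkH : (M + k : ℝ) ^ k * H ≤ (D * L) ^ k * D ^ k :=
    mul_le_mul (pow_le_pow_left₀ (by positivity) hMk k) hHD hH0 (by positivity)
  set E := (D * L) ^ k * D ^ k
  have hE : 0 ≤ E := by positivity
  calc (M : ℝ) * (5 * H ^ 2 + 2 * ((M + k : ℝ) ^ k * H))
        + (5 * H ^ 2 + 2 * (2 ^ k * k.factorial * H))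
      ≤ D * L * (5 * E + 2 * E) + 1 * (5 * E + 2 * E) := by
        rw [one_mul]
        refine add_le_add (mul_le_mul hMD (by linarith) (by positivity) (by positivity))
          (by linarith)
    _ ≤ 14 * (D * L * E) := by nlinarith
    _ = 14 * (D ^ (2 * k + 1) * L ^ (k + 1)) := by rw [hpow]
    _ ≤ 14 ^ (2 * k + 1) * (D ^ (2 * k + 1) * L ^ (k + 1)) :=
        mul_le_mul_of_nonneg_right (le_self_pow₀ (by norm_num) (by omega)) (by positivity)
    _ = (70 + 28 * (h : ℝ)) ^ (2 * k + 1) * L ^ (k + 1) := by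
        rw [← mul_assoc, ← mul_pow]
        congr 2
        rw [hD]
        ring

/-- Here `L ^ (k + 1) ≥ L ^ (2L) ≥ n`, so the trivial error bound `h ^ (2k)` is already enough. -/
theorem individualRegret_le_of_large_degree {π : ProbabilityMeasure ℝ≥0} {h : ℝ≥0}
    (hπ : π ∈ boundedPriors h) {k n : ℕ} {hn : 0 < n}
    {T : (Fin n → ℕ) → Fin n → ℝ} (hT : IsERM (clippedMonotoneClass 0 ((h : ℝ) ^ k)) k n T)
    {L : ℝ} (hL : 1 ≤ Real.log L) (hL0 : 1 ≤ L) (hnL : Real.log n ≤ 2 * L * Real.log L)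
    (hkL : 2 * L ≤ k) :
    individualRegret k n hn π T
      ≤ (((70 + 28 * (h : ℝ)) ^ (2 * k + 1) * L ^ (k + 1) / n : ℝ) : EReal) := by
  have hh : (0 : ℝ) ≤ h := h.2
  have hn' : (0 : ℝ) < n := by exact_mod_cast hn
  refine individualRegret_le_of_lastMSE_le π (by positivity) ?_
  calc _ ≤ ∫⁻ _, ENNReal.ofReal (((h : ℝ) ^ k) ^ 2) ∂(Measure.pi fun _ : Fin n => obsLaw π) := by
        refine lintegral_mono fun x => ENNReal.ofReal_le_ofReal ?_
        obtain ⟨t, htF, -, ht⟩ := hT x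
        rw [ht]
        have h1 := htF.2 (x (lastIndex n hn))
        have h2 := bayes_nonneg π k (x (lastIndex n hn))
        have h3 := bayes_le_of_mem_boundedPriors hπ k (x (lastIndex n hn))
        exact sq_le_sq.2 (abs_le_abs (by linarith) (by linarith))
    _ = ENNReal.ofReal (((h : ℝ) ^ k) ^ 2) := by simp
    _ ≤ _ := by
        refine ENNReal.ofReal_le_ofReal ?_
        have hLn : (n : ℝ) ≤ L ^ (k + 1) := by
          rw [← Real.log_le_log_iff hn' (by positivity), Real.log_pow]
          push_cast
          have := mul_le_mul_of_nonneg_right hkL (by linarith : 0 ≤ Real.log L)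
          linarith
        have hh2 : ((h : ℝ) ^ k) ^ 2 ≤ (70 + 28 * (h : ℝ)) ^ (2 * k + 1) := by
          calc ((h : ℝ) ^ k) ^ 2 = (h : ℝ) ^ (2 * k) := by ring
            _ ≤ (70 + 28 * (h : ℝ)) ^ (2 * k) := pow_le_pow_left₀ hh (by linarith) _
            _ ≤ _ := pow_le_pow_right₀ (by linarith) (by omega)
        rw [le_div_iff₀ hn']
        exact mul_le_mul hh2 hLn hn'.le (by positivity)

theorem individualRegret_le_of_mem_boundedPriors {π : ProbabilityMeasure ℝ≥0} {h : ℝ≥0}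
    (hπ : π ∈ boundedPriors h) {k n : ℕ} (hk : 1 ≤ k) (hn3 : 3 ≤ n) {hn : 0 < n}
    {T : (Fin n → ℕ) → Fin n → ℝ} (hT : IsERM (clippedMonotoneClass 0 ((h : ℝ) ^ k)) k n T) :
    individualRegret k n hn π T ≤ (((70 + 28 * (h : ℝ)) ^ (2 * k + 1)
      * (Real.log n / Real.log (Real.log n)) ^ (k + 1) / n : ℝ) : EReal) := by
  have hu := one_lt_log_of_three_le hn3
  have hL := one_le_log_div_log hu
  have hL0 : 1 ≤ Real.log n / Real.log (Real.log n) := by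
    have h0 : 0 < Real.log n / Real.log (Real.log n) :=
      div_pos (by linarith) (Real.log_pos hu)
    linarith [Real.log_le_sub_one_of_pos h0]
  rcases le_total (k : ℝ) (2 * (Real.log n / Real.log (Real.log n))) with hk' | hk'
  · exact individualRegret_le_of_small_degree hπ hk hT hL hL0 (le_two_mul_div_log_mul_log hu) hk'
  · exact individualRegret_le_of_large_degree hπ hT hL hL0 (le_two_mul_div_log_mul_log hu) hk'

/-! ### Subexponential priors -/

theorem tsum_descFactorial_mul_cellCount {n : ℕ} (k : ℕ) (x : Fin n → ℕ) :
    ∑' y, ENNReal.ofReal ((y + k).descFactorial k * cellCount (y + k) x)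
      = ENNReal.ofReal (∑ i, ((x i).descFactorial k : ℝ)) := by
  have hR : ∀ i, x i < (∑ j, x j) + 1 := fun i => Nat.lt_succ_of_le
    (Finset.single_le_sum (f := x) (fun j _ => Nat.zero_le _) (Finset.mem_univ i))
  have h := sum_descFactorial_eq_sum_cellCount hR k fun _ => 1
  simp only [mul_one] at h
  rw [h, ENNReal.ofReal_sum_of_nonneg fun y _ => by positivity]
  refine tsum_eq_sum fun y hy => ?_
  have h0 : cellCount (y + k) x = 0 := by
    rw [cellCount, Finset.card_eq_zero]
    ext i
    have := hR i
    simp only [Finset.mem_range] at hy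
    simp
    omega
  simp [h0]

/-- The contribution of the empty cells, when the estimator is not clipped. -/
theorem tsum_empty_cells_le {n : ℕ} (hn : 0 < n) (k M : ℕ) {x : Fin n → ℕ} {t : ℕ → ℝ}
    (ht : t ∈ monotoneClass) (hmin : IsMinOn (empiricalRisk k x) monotoneClass t) :
    ∑' y, ENNReal.ofReal (if cellCount y x = 0 then
        (y + k).descFactorial k * cellCount (y + k) x * t y else 0)
      ≤ ENNReal.ofReal ((M : ℝ) ^ k) * ∑' y, ENNReal.ofReal (if cellCount y x = 0 then
          (y + k).descFactorial k * cellCount (y + k) x else 0)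
        + n * ∑ j, if M ≤ x j then ENNReal.ofReal ((x j : ℝ) ^ (2 * k)) else 0 := by
  -- An empty cell `y` counts only if `y + k` was observed; then monotonicity bounds `t y` by a
  -- value on the sample, hence by any bound on the responses.
  have key : ∀ B : ℝ, (∀ i, ((x i).descFactorial k : ℝ) ≤ B) → ∀ y,
      ((y + k).descFactorial k * cellCount (y + k) x * t y : ℝ)
        ≤ B * ((y + k).descFactorial k * cellCount (y + k) x) := by
    intro B hB y
    rcases Nat.eq_zero_or_pos (cellCount (y + k) x) with h0 | h0
    · simp [h0]
    · obtain ⟨i, hi⟩ := Finset.card_pos.1 h0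
      have hi' : x i = y + k := by simpa using hi
      have h1 : t y ≤ B := (monotone_of_mem_monotoneClass ht (by omega : y ≤ x i)).trans
        (le_of_isMinOn_monotoneClass hn ht hmin hB i)
      rw [mul_comm B]
      exact mul_le_mul_of_nonneg_left h1 (by positivity)
  by_cases hM : ∀ j, x j < M
  · refine le_trans ?_ le_self_add
    rw [← ENNReal.tsum_mul_left]
    refine ENNReal.tsum_le_tsum fun y => ?_
    rw [← ENNReal.ofReal_mul (by positivity)]
    refine ENNReal.ofReal_le_ofReal ?_
    split_ifs
    · refine key _ (fun i => ?_) y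
      refine (Nat.cast_le.2 (Nat.descFactorial_le_pow _ _)).trans ?_
      exact_mod_cast Nat.pow_le_pow_left (hM i).le k
    · simp
  -- On this rare event the largest observation bounds both the estimator and each response, at a
  -- crude cost of `n * (max x) ^ (2k)`.
  · push Not at hM
    obtain ⟨j, hj⟩ := hM
    have : Nonempty (Fin n) := ⟨j⟩
    obtain ⟨m, hm⟩ := Finite.exists_max x
    have hB : ∀ i, ((x i).descFactorial k : ℝ) ≤ (x m : ℝ) ^ k := fun i => by
      exact_mod_cast (Nat.descFactorial_le_pow _ _).trans (Nat.pow_le_pow_left (hm i) k)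
    refine le_trans ?_ le_add_self
    calc _ ≤ ∑' y, ENNReal.ofReal ((x m : ℝ) ^ k)
          * ENNReal.ofReal ((y + k).descFactorial k * cellCount (y + k) x) := by
          refine ENNReal.tsum_le_tsum fun y => ?_
          rw [← ENNReal.ofReal_mul (by positivity)]
          refine ENNReal.ofReal_le_ofReal ?_
          split_ifs
          · exact key _ hB y
          · positivity
      _ ≤ ENNReal.ofReal (n * (x m : ℝ) ^ (2 * k)) := by
          rw [ENNReal.tsum_mul_left, tsum_descFactorial_mul_cellCount,
            ← ENNReal.ofReal_mul (by positivity)]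
          refine ENNReal.ofReal_le_ofReal ?_
          have h1 : ∑ i, ((x i).descFactorial k : ℝ) ≤ n * (x m : ℝ) ^ k := by
            refine (Finset.sum_le_card_nsmul _ _ _ fun i _ => hB i).trans (le_of_eq ?_)
            simp
          calc (x m : ℝ) ^ k * ∑ i, ((x i).descFactorial k : ℝ)
              ≤ (x m : ℝ) ^ k * (n * (x m : ℝ) ^ k) :=
                mul_le_mul_of_nonneg_left h1 (by positivity)
            _ = _ := by ring
      _ ≤ _ := by
          rw [ENNReal.ofReal_mul (Nat.cast_nonneg n), ENNReal.ofReal_natCast]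
          refine mul_le_mul_right ?_ _
          refine le_trans (le_of_eq ?_) (Finset.single_le_sum
            (f := fun j => if M ≤ x j then ENNReal.ofReal ((x j : ℝ) ^ (2 * k)) else 0)
            (fun _ _ => zero_le) (Finset.mem_univ m))
          exact (if_pos (hj.trans (hm j))).symm

theorem lintegral_pi_sum_comp {n : ℕ} (P : Measure ℕ) [IsProbabilityMeasure P] (f : ℕ → ℝ≥0∞) :
    ∫⁻ x, ∑ j, f (x j) ∂(Measure.pi fun _ : Fin n => P) = n * ∫⁻ y, f y ∂P := by
  rw [lintegral_finsetSum _ fun i _ => Measurable.of_discrete,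
    Finset.sum_congr rfl fun i _ =>
      (measurePreserving_eval (fun _ : Fin n => P) i).lintegral_comp (f := f) Measurable.of_discrete]
  simp

/-- Truncation can only help the excess: `(a - b) * min 1 (n p) ≤ n (a - b) p ≤ n r`. -/
theorem mul_min_one_le_of_mul_le {a b p r : ℝ≥0∞} (hp : p ≠ ∞) (n : ℝ≥0∞) (h : a * p ≤ b * p + r) :
    a * min 1 (n * p) ≤ b * min 1 (n * p) + n * r := by
  rcases le_total 1 (n * p) with h1 | h1
  · rw [min_eq_left h1, mul_one, mul_one]
    have h2 : (a - b) * p ≤ r := by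
      rw [ENNReal.sub_mul fun _ _ => hp]
      exact tsub_le_iff_left.2 h
    calc a ≤ b + (a - b) := le_add_tsub
      _ ≤ b + (a - b) * (n * p) := by
          gcongr
          exact le_mul_of_one_le_right' h1
      _ = b + n * ((a - b) * p) := by rw [mul_left_comm]
      _ ≤ b + n * r := by gcongr
  · rw [min_eq_right h1]
    calc a * (n * p) = n * (a * p) := mul_left_comm _ _ _
      _ ≤ n * (b * p + r) := by gcongr
      _ = _ := by rw [mul_add, mul_left_comm]

/-- Substitute for the uniform bound on `bayes`: Jensen's inequality, then a split of `θ ^ (2k)` at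
`M`. -/
theorem bayes_sq_mul_obsLaw_le (π : ProbabilityMeasure ℝ≥0) (k M y : ℕ) :
    ENNReal.ofReal (bayes k π y ^ 2) * obsLaw π {y}
      ≤ ENNReal.ofReal ((M : ℝ) ^ (2 * k)) * obsLaw π {y}
        + ∫⁻ θ, (if (M : ℝ) ≤ θ then ENNReal.ofReal ((θ : ℝ) ^ (2 * k)) else 0)
          * ENNReal.ofReal (poissonWeight y θ) ∂(π : Measure ℝ≥0) := by
  have hw := ofReal_cellMoment π 0 y
  simp only [pow_zero, ENNReal.ofReal_one, one_mul] at hw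
  calc ENNReal.ofReal (bayes k π y ^ 2) * obsLaw π {y}
      ≤ ENNReal.ofReal (cellMoment π (2 * k) y) := by
        rw [obsLaw_singleton, ← ENNReal.ofReal_mul (sq_nonneg _)]
        exact ENNReal.ofReal_le_ofReal (bayes_sq_mul_cellMoment_le π k y)
    _ ≤ _ := by
        rw [ofReal_cellMoment, obsLaw_singleton, hw, ← lintegral_const_mul _ (by fun_prop),
          ← lintegral_add_left (by fun_prop)]
        refine lintegral_mono fun θ => ?_
        dsimp only
        rw [← add_mul]
        refine mul_le_mul_left ?_ _
        split_ifs with hθ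
        · exact le_add_self
        · rw [add_zero]
          exact ENNReal.ofReal_le_ofReal (pow_le_pow_left₀ θ.2 (not_le.1 hθ).le _)

theorem tsum_lintegral_mul_poissonWeight (π : ProbabilityMeasure ℝ≥0) {f : ℝ≥0 → ℝ≥0∞}
    (hf : Measurable f) :
    ∑' y, ∫⁻ θ, f θ * ENNReal.ofReal (poissonWeight y θ) ∂(π : Measure ℝ≥0)
      = ∫⁻ θ, f θ ∂(π : Measure ℝ≥0) := by
  rw [← lintegral_tsum fun y => by fun_prop]
  refine lintegral_congr fun θ => ?_
  rw [ENNReal.tsum_mul_left, tsum_ofReal_poissonWeight, mul_one]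

theorem lintegral_tail_eq_tsum (P : Measure ℕ) (M : ℕ) (f : ℕ → ℝ≥0∞) :
    ∫⁻ y, (if M ≤ y then f y else 0) ∂P = ∑' y, if M ≤ y then f y * P {y} else 0 := by
  rw [lintegral_countable']
  exact tsum_congr fun y => by split_ifs <;> simp

/-- A bound on the training error of the unclipped minimizer in terms of a truncation level `M`. -/
theorem lintegral_sum_sq_le_truncated (π : ProbabilityMeasure ℝ≥0) {k n : ℕ} (hk : 1 ≤ k)
    (hn : 0 < n) {T : (Fin n → ℕ) → Fin n → ℝ} (hT : IsERM monotoneClass k n T) (M : ℕ) :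
    ∫⁻ x, ENNReal.ofReal (∑ i, (T x i - bayes k π (x i)) ^ 2) ∂(Measure.pi fun _ => obsLaw π)
      ≤ ENNReal.ofReal (7 * (M + k : ℝ) ^ (2 * k + 1))
        + 5 * (n * ∫⁻ θ, (if (M : ℝ) ≤ θ then ENNReal.ofReal ((θ : ℝ) ^ (2 * k)) else 0)
          ∂(π : Measure ℝ≥0))
        + 9 * (n ^ 2 * ∫⁻ y, (if M ≤ y then ENNReal.ofReal ((y + k : ℝ) ^ (2 * k)) else 0)
          ∂(obsLaw π)) := by
  choose t htF ht hTt using hT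
  have hmeas : Measurable fun θ : ℝ≥0 =>
      (if (M : ℝ) ≤ θ then ENNReal.ofReal ((θ : ℝ) ^ (2 * k)) else 0) :=
    Measurable.ite (measurableSet_le measurable_const measurable_coe_nnreal_real)
      (by fun_prop) measurable_const
  set ρ := ∫⁻ θ, (if (M : ℝ) ≤ θ then ENNReal.ofReal ((θ : ℝ) ^ (2 * k)) else 0)
    ∂(π : Measure ℝ≥0) with hρ
  set τ := ∫⁻ y, (if M ≤ y then ENNReal.ofReal ((y + k : ℝ) ^ (2 * k)) else 0) ∂(obsLaw π) with hτ
  have hempty : ∫⁻ x, ∑' y, ENNReal.ofReal (if cellCount y x = 0 then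
          (y + k).descFactorial k * cellCount (y + k) x * t x y else 0)
          ∂(Measure.pi fun _ => obsLaw π)
      ≤ ∑' y, ENNReal.ofReal ((M : ℝ) ^ k * bayes k π y) * min 1 (n * obsLaw π {y})
        + n ^ 2 * τ := by
    refine (lintegral_mono fun x => tsum_empty_cells_le hn k M (htF x) (ht x)).trans ?_
    rw [lintegral_add_left Measurable.of_discrete, lintegral_const_mul _ Measurable.of_discrete,
      lintegral_const_mul _ Measurable.of_discrete,
      lintegral_tsum fun y => Measurable.of_discrete.aemeasurable,
      lintegral_pi_sum_comp (obsLaw π)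
        (fun y => if M ≤ y then ENNReal.ofReal ((y : ℝ) ^ (2 * k)) else 0),
      ← mul_assoc, ← sq, ← ENNReal.tsum_mul_left]
    refine add_le_add (ENNReal.tsum_le_tsum fun y => ?_) (mul_le_mul_right ?_ _)
    · rw [ENNReal.ofReal_mul (by positivity), mul_assoc]
      exact mul_le_mul_right (lintegral_cellCount_empty_le (obsLaw π) (by omega)
        (Nat.cast_nonneg _) (bayes_nonneg π k y) (descFactorial_mul_obsLaw π k y)) _
    · refine lintegral_mono fun y => ?_
      dsimp only
      split_ifs
      · refine ENNReal.ofReal_le_ofReal (pow_le_pow_left₀ (by positivity) ?_ _)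
        linarith [(Nat.cast_nonneg k : (0 : ℝ) ≤ k)]
      · exact le_rfl
  have hcell : ∀ y, ENNReal.ofReal (3 * bayes k π y ^ 2
        + 2 * (((y + k).descFactorial k : ℝ) * bayes k π y)) * min 1 (n * obsLaw π {y})
      + 2 * (ENNReal.ofReal ((M : ℝ) ^ k * bayes k π y) * min 1 (n * obsLaw π {y}))
      ≤ ENNReal.ofReal (((y + k).descFactorial k : ℝ) ^ 2 + 6 * (M : ℝ) ^ (2 * k))
          * min 1 (n * obsLaw π {y})
        + 5 * (n * ∫⁻ θ, (if (M : ℝ) ≤ θ then ENNReal.ofReal ((θ : ℝ) ^ (2 * k)) else 0)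
          * ENNReal.ofReal (poissonWeight y θ) ∂(π : Measure ℝ≥0)) := by
    intro y
    have hb0 := bayes_nonneg π k y
    have hsq := mul_min_one_le_of_mul_le (measure_ne_top (obsLaw π) {y}) n
      (bayes_sq_mul_obsLaw_le π k M y)
    set μ := min 1 ((n : ℝ≥0∞) * obsLaw π {y})
    set r := ∫⁻ θ, (if (M : ℝ) ≤ θ then ENNReal.ofReal ((θ : ℝ) ^ (2 * k)) else 0)
          * ENNReal.ofReal (poissonWeight y θ) ∂(π : Measure ℝ≥0)
    set c : ℝ := (((y + k).descFactorial k : ℕ) : ℝ)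
    have hc : 0 ≤ c := Nat.cast_nonneg _
    calc _ = ENNReal.ofReal (3 * bayes k π y ^ 2 + 2 * (c * bayes k π y)
          + 2 * ((M : ℝ) ^ k * bayes k π y)) * μ := by
          rw [ENNReal.ofReal_add (p := 3 * bayes k π y ^ 2 + 2 * (c * bayes k π y)) (by positivity)
            (by positivity), ENNReal.ofReal_mul zero_le_two, ENNReal.ofReal_ofNat, add_mul,
            mul_assoc]
      -- `2uv ≤ u² + v²` on both cross terms, whence `3 + 1 + 1 = 5`; replacing `bayes²` by `M ^
      -- (2k)` then makes the coefficient of `M ^ (2k)` equal to `5 + 1 = 6`.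
      _ ≤ ENNReal.ofReal (5 * bayes k π y ^ 2 + (c ^ 2 + (M : ℝ) ^ (2 * k))) * μ := by
          refine mul_le_mul_left (ENNReal.ofReal_le_ofReal ?_) _
          have e : (M : ℝ) ^ (2 * k) = ((M : ℝ) ^ k) ^ 2 := by ring
          rw [e]
          nlinarith [sq_nonneg (c - bayes k π y), sq_nonneg ((M : ℝ) ^ k - bayes k π y)]
      _ = 5 * (ENNReal.ofReal (bayes k π y ^ 2) * μ)
          + ENNReal.ofReal (c ^ 2 + (M : ℝ) ^ (2 * k)) * μ := by
          rw [ENNReal.ofReal_add (by positivity) (by positivity),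
            ENNReal.ofReal_mul (by positivity), ENNReal.ofReal_ofNat, add_mul, mul_assoc]
      _ ≤ 5 * (ENNReal.ofReal ((M : ℝ) ^ (2 * k)) * μ + n * r)
          + ENNReal.ofReal (c ^ 2 + (M : ℝ) ^ (2 * k)) * μ := by gcongr
      _ = _ := by
          have e : c ^ 2 + 6 * (M : ℝ) ^ (2 * k)
              = 5 * (M : ℝ) ^ (2 * k) + (c ^ 2 + (M : ℝ) ^ (2 * k)) := by ring
          rw [e, ENNReal.ofReal_add (p := 5 * (M : ℝ) ^ (2 * k)) (by positivity) (by positivity),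
            ENNReal.ofReal_mul (by positivity), ENNReal.ofReal_ofNat]
          ring
  have hhead : ∑ y ∈ Finset.range M,
      ENNReal.ofReal (((y + k).descFactorial k : ℝ) ^ 2 + 6 * (M : ℝ) ^ (2 * k))
      ≤ ENNReal.ofReal (7 * (M + k : ℝ) ^ (2 * k + 1)) := by
    have h1 : ∀ y ∈ Finset.range M,
        ENNReal.ofReal (((y + k).descFactorial k : ℝ) ^ 2 + 6 * (M : ℝ) ^ (2 * k))
        ≤ ENNReal.ofReal (7 * (M + k : ℝ) ^ (2 * k)) := by
      intro y hy
      refine ENNReal.ofReal_le_ofReal ?_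
      have hy' : (y : ℝ) ≤ M := by exact_mod_cast (Finset.mem_range.1 hy).le
      have h2 : ((y + k).descFactorial k : ℝ) ^ 2 ≤ (M + k : ℝ) ^ (2 * k) := by
        calc ((y + k).descFactorial k : ℝ) ^ 2 ≤ (((y + k : ℕ) : ℝ) ^ k) ^ 2 :=
              pow_le_pow_left₀ (by positivity) (by exact_mod_cast Nat.descFactorial_le_pow _ _) 2
          _ = ((y + k : ℕ) : ℝ) ^ (2 * k) := by ring
          _ ≤ _ := pow_le_pow_left₀ (by positivity) (by push_cast; linarith) _
      have h3 : (M : ℝ) ^ (2 * k) ≤ (M + k : ℝ) ^ (2 * k) :=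
        pow_le_pow_left₀ (by positivity) (by linarith [(Nat.cast_nonneg k : (0 : ℝ) ≤ k)]) _
      linarith
    refine (Finset.sum_le_card_nsmul _ _ _ h1).trans ?_
    rw [Finset.card_range, nsmul_eq_mul, ← ENNReal.ofReal_natCast,
      ← ENNReal.ofReal_mul (Nat.cast_nonneg M)]
    refine ENNReal.ofReal_le_ofReal ?_
    have h0 : (M : ℝ) ≤ M + k := by linarith [(Nat.cast_nonneg k : (0 : ℝ) ≤ k)]
    have := mul_le_mul_of_nonneg_right h0 (show 0 ≤ 7 * (M + k : ℝ) ^ (2 * k) by positivity)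
    rw [pow_succ]
    linarith
  have htail : ∑' y, (if M ≤ y then
      ENNReal.ofReal (((y + k).descFactorial k : ℝ) ^ 2 + 6 * (M : ℝ) ^ (2 * k)) * obsLaw π {y}
      else 0) ≤ 7 * τ := by
    rw [hτ, lintegral_tail_eq_tsum, ← ENNReal.tsum_mul_left]
    refine ENNReal.tsum_le_tsum fun y => ?_
    split_ifs with hy
    · rw [← mul_assoc, ← ENNReal.ofReal_ofNat 7, ← ENNReal.ofReal_mul (by norm_num)]
      refine mul_le_mul_left (ENNReal.ofReal_le_ofReal ?_) _
      have h2 : ((y + k).descFactorial k : ℝ) ^ 2 ≤ (y + k : ℝ) ^ (2 * k) := by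
        calc ((y + k).descFactorial k : ℝ) ^ 2 ≤ (((y + k : ℕ) : ℝ) ^ k) ^ 2 :=
              pow_le_pow_left₀ (by positivity) (by exact_mod_cast Nat.descFactorial_le_pow _ _) 2
          _ = (y + k : ℝ) ^ (2 * k) := by push_cast; ring
      have hy' : (M : ℝ) ≤ y := by exact_mod_cast hy
      have h3 : (M : ℝ) ^ (2 * k) ≤ (y + k : ℝ) ^ (2 * k) :=
        pow_le_pow_left₀ (by positivity) (by linarith [(Nat.cast_nonneg k : (0 : ℝ) ≤ k)]) _
      linarith
    · simp
  have hn1 : (n : ℝ≥0∞) ≤ n ^ 2 := by exact_mod_cast Nat.le_self_pow two_ne_zero n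
  calc _ ≤ ∑' y, ENNReal.ofReal (3 * bayes k π y ^ 2
          + 2 * (((y + k).descFactorial k : ℝ) * bayes k π y)) * min 1 (n * obsLaw π {y})
        + 2 * (∑' y, ENNReal.ofReal ((M : ℝ) ^ k * bayes k π y) * min 1 (n * obsLaw π {y})
          + n ^ 2 * τ) :=
        (lintegral_sum_sq_le π convex_monotoneClass hk hn htF ht hTt
          (bayes_mem_monotoneClass π hk)).trans (by gcongr)
    _ = ∑' y, (ENNReal.ofReal (3 * bayes k π y ^ 2
          + 2 * (((y + k).descFactorial k : ℝ) * bayes k π y)) * min 1 (n * obsLaw π {y})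
          + 2 * (ENNReal.ofReal ((M : ℝ) ^ k * bayes k π y) * min 1 (n * obsLaw π {y})))
        + 2 * (n ^ 2 * τ) := by
        rw [ENNReal.tsum_add, ENNReal.tsum_mul_left, mul_add, add_assoc]
    _ ≤ (ENNReal.ofReal (7 * (M + k : ℝ) ^ (2 * k + 1)) + n * (7 * τ) + 5 * (n * ρ))
        + 2 * (n ^ 2 * τ) := by
        refine add_le_add_left ?_ _
        refine (ENNReal.tsum_le_tsum hcell).trans ?_
        rw [ENNReal.tsum_add, ENNReal.tsum_mul_left, ENNReal.tsum_mul_left,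
          tsum_lintegral_mul_poissonWeight π hmeas]
        gcongr
        refine (tsum_mul_min_le _ _ M n).trans ?_
        gcongr
    -- `n ≤ n²` merges the two observation tails into `7 + 2 = 9`.
    _ ≤ (ENNReal.ofReal (7 * (M + k : ℝ) ^ (2 * k + 1)) + n ^ 2 * (7 * τ) + 5 * (n * ρ))
        + 2 * (n ^ 2 * τ) := by gcongr
    _ = _ := by ring

/-- The value `∑ⱼ 2 exp ((1 - j) / 2)`, which bounds `E[exp (θ / (2 s))]` over `SubE(s)`. -/
noncomputable def subexpMoment : ℝ := ∑' j : ℕ, 2 * Real.exp ((1 - j) / 2)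

theorem summable_subexpMoment : Summable fun j : ℕ => 2 * Real.exp ((1 - (j : ℝ)) / 2) := by
  have h := (Real.summable_exp_nat_mul_iff.2 (show (-1 / 2 : ℝ) < 0 by norm_num)).mul_left
    (2 * Real.exp (1 / 2))
  refine h.congr fun j => ?_
  rw [mul_assoc, ← Real.exp_add]
  congr 2
  ring

theorem subexpMoment_nonneg : 0 ≤ subexpMoment := tsum_nonneg fun _ => by positivity

/-- Slice `θ` into intervals of length `s`: on the `j`-th one the exponential is at most `exp ((j +
1) / 2)`, against a tail `2 exp (-j)`. -/
theorem lintegral_exp_le_of_mem_subexponentialPriors {π : ProbabilityMeasure ℝ≥0} {s : ℝ}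
    (hs : 0 < s) (hπ : π ∈ subexponentialPriors s) :
    ∫⁻ θ, ENNReal.ofReal (Real.exp ((θ : ℝ) / (2 * s))) ∂(π : Measure ℝ≥0)
      ≤ ENNReal.ofReal subexpMoment := by
  have hmeas : ∀ j : ℕ, MeasurableSet {θ : ℝ≥0 | (j : ℝ) * s ≤ θ} := fun j =>
    measurableSet_le measurable_const measurable_coe_nnreal_real
  calc ∫⁻ θ, ENNReal.ofReal (Real.exp ((θ : ℝ) / (2 * s))) ∂(π : Measure ℝ≥0)
      ≤ ∫⁻ θ, ∑' j : ℕ, {θ : ℝ≥0 | (j : ℝ) * s ≤ θ}.indicator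
          (fun _ => ENNReal.ofReal (Real.exp ((j + 1) / 2))) θ ∂(π : Measure ℝ≥0) := by
        refine lintegral_mono fun θ => ?_
        have hq : 0 ≤ (θ : ℝ) / s := div_nonneg θ.2 hs.le
        refine le_trans ?_ (ENNReal.le_tsum ⌊(θ : ℝ) / s⌋₊)
        rw [Set.indicator_of_mem]
        · refine ENNReal.ofReal_le_ofReal (Real.exp_le_exp.2 ?_)
          have := (Nat.lt_floor_add_one ((θ : ℝ) / s)).le
          calc (θ : ℝ) / (2 * s) = (θ : ℝ) / s / 2 := by field_simp
            _ ≤ _ := by linarith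
        · exact (le_div_iff₀ hs).1 (Nat.floor_le hq)
    _ = ∑' j : ℕ, ENNReal.ofReal (Real.exp ((j + 1) / 2))
          * (π : Measure ℝ≥0) {θ : ℝ≥0 | (j : ℝ) * s ≤ θ} := by
        rw [lintegral_tsum fun j => (measurable_const.indicator (hmeas j)).aemeasurable]
        exact tsum_congr fun j => lintegral_indicator_const (hmeas j) _
    _ ≤ ∑' j : ℕ, ENNReal.ofReal (2 * Real.exp ((1 - (j : ℝ)) / 2)) := by
        refine ENNReal.tsum_le_tsum fun j => ?_
        have hj : (π : Measure ℝ≥0) {θ : ℝ≥0 | (j : ℝ) * s ≤ θ}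
            ≤ ENNReal.ofReal (2 * Real.exp (-j)) := by
          -- The tail hypothesis covers only `t > 0`; at `j = 0` the bound is `1 ≤ 2`.
          rcases Nat.eq_zero_or_pos j with h0 | h0
          · refine prob_le_one.trans ?_
            simp [h0]
          · refine (hπ (j * s) (by positivity)).trans (le_of_eq ?_)
            congr 3
            field_simp
        refine (mul_le_mul_right hj _).trans (le_of_eq ?_)
        rw [← ENNReal.ofReal_mul (Real.exp_nonneg _), mul_left_comm, ← Real.exp_add]
        congr 3
        ring
    _ = ENNReal.ofReal subexpMoment :=
        (ENNReal.ofReal_tsum_of_nonneg (fun _ => by positivity) summable_subexpMoment).symm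

/-- The probability generating function of one observation. -/
theorem lintegral_pow_obsLaw (π : ProbabilityMeasure ℝ≥0) {q : ℝ} (hq : 0 ≤ q) :
    ∫⁻ x, ENNReal.ofReal (q ^ x) ∂(obsLaw π)
      = ∫⁻ θ, ENNReal.ofReal (Real.exp ((θ : ℝ) * (q - 1))) ∂(π : Measure ℝ≥0) := by
  have hw := fun x => ofReal_cellMoment π 0 x
  simp only [pow_zero, ENNReal.ofReal_one, one_mul] at hw
  rw [lintegral_countable']
  simp_rw [obsLaw_singleton, hw]
  rw [tsum_congr fun x => (lintegral_const_mul (ENNReal.ofReal (q ^ x))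
    (by fun_prop : Measurable fun θ => ENNReal.ofReal (poissonWeight x θ))).symm,
    ← lintegral_tsum fun x => by fun_prop]
  refine lintegral_congr fun θ => ?_
  have hs : HasSum (fun x : ℕ => Real.exp (-(θ : ℝ)) * ((q * θ) ^ x / x.factorial))
      (Real.exp (-(θ : ℝ)) * Real.exp (q * θ)) := by
    refine HasSum.mul_left _ ?_
    rw [Real.exp_eq_exp_ℝ]
    exact NormedSpace.expSeries_div_hasSum_exp (q * (θ : ℝ))
  have e : (θ : ℝ) * (q - 1) = -θ + q * θ := by ring
  rw [e, Real.exp_add, ← hs.tsum_eq, ENNReal.ofReal_tsum_of_nonneg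
    (fun x => mul_nonneg (Real.exp_nonneg _) (by positivity)) hs.summable]
  refine tsum_congr fun x => ?_
  rw [← ENNReal.ofReal_mul (by positivity), poissonWeight]
  congr 1
  rw [mul_pow]
  ring

theorem pow_le_factorial_mul_exp {l y : ℝ} (hl : 0 < l) (hy : 0 ≤ y) (m : ℕ) :
    y ^ m ≤ m.factorial / l ^ m * Real.exp (l * y) := by
  have h := Real.pow_div_factorial_le_exp (l * y) (by positivity) m
  rw [div_le_iff₀ (by positivity), mul_pow] at h
  rw [div_mul_eq_mul_div, le_div_iff₀ (by positivity)]
  linarith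

/-- The available exponent `1 / (2s)` is halved: one half absorbs the power, the other gives the
decay in `M`. -/
theorem lintegral_prior_tail_le {π : ProbabilityMeasure ℝ≥0} {s : ℝ}
    (hs : 0 < s) (hπ : π ∈ subexponentialPriors s) (m M : ℕ) :
    ∫⁻ θ, (if (M : ℝ) ≤ θ then ENNReal.ofReal ((θ : ℝ) ^ m) else 0) ∂(π : Measure ℝ≥0)
      ≤ ENNReal.ofReal (m.factorial / (1 / (4 * s)) ^ m * Real.exp (-(1 / (4 * s) * M))
        * subexpMoment) := by
  set l := 1 / (4 * s) with hl
  have hl0 : 0 < l := by positivity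
  rw [ENNReal.ofReal_mul (by positivity)]
  refine le_trans ?_ (mul_le_mul_right (lintegral_exp_le_of_mem_subexponentialPriors hs hπ) _)
  rw [← lintegral_const_mul _ (by fun_prop)]
  refine lintegral_mono fun θ => ?_
  dsimp only
  split_ifs with hθ
  · rw [← ENNReal.ofReal_mul (by positivity)]
    refine ENNReal.ofReal_le_ofReal ((pow_le_factorial_mul_exp hl0 θ.2 m).trans ?_)
    rw [mul_assoc, ← Real.exp_add]
    refine mul_le_mul_of_nonneg_left (Real.exp_le_exp.2 ?_) (by positivity)
    have e : (θ : ℝ) / (2 * s) = 2 * (l * θ) := by rw [hl]; field_simp; ring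
    have := mul_le_mul_of_nonneg_left hθ hl0.le
    rw [e]
    change l * (θ : ℝ) ≤ _
    linarith
  · exact zero_le

/-- The choice of `l` turns the generating function at `exp (2l)` into the exponential moment of the
prior at `1 / (2s)`. One `l` absorbs the power, the other gives the decay. -/
theorem lintegral_obsLaw_tail_le {π : ProbabilityMeasure ℝ≥0} {s : ℝ}
    (hs : 0 < s) (hπ : π ∈ subexponentialPriors s) {l : ℝ} (hl0 : 0 < l)
    (hl : Real.exp (2 * l) = 1 + 1 / (2 * s)) (k m M : ℕ) :
    ∫⁻ y, (if M ≤ y then ENNReal.ofReal ((y + k : ℝ) ^ m) else 0) ∂(obsLaw π)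
      ≤ ENNReal.ofReal (m.factorial / l ^ m * Real.exp (l * k) * Real.exp (-(l * M))
        * subexpMoment) := by
  have h1 := lintegral_exp_le_of_mem_subexponentialPriors hs hπ
  have h2 := lintegral_pow_obsLaw π (Real.exp_nonneg (2 * l))
  have e : ∀ θ : ℝ, θ * (Real.exp (2 * l) - 1) = θ / (2 * s) := fun θ => by rw [hl]; ring
  simp only [e] at h2
  rw [← h2] at h1
  rw [ENNReal.ofReal_mul (by positivity)]
  refine le_trans ?_ (mul_le_mul_right h1 _)
  rw [← lintegral_const_mul _ Measurable.of_discrete]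
  refine lintegral_mono fun y => ?_
  dsimp only
  split_ifs with hy
  · rw [← ENNReal.ofReal_mul (by positivity)]
    refine ENNReal.ofReal_le_ofReal
      ((pow_le_factorial_mul_exp hl0 (by positivity : (0 : ℝ) ≤ y + k) m).trans ?_)
    rw [← Real.exp_nat_mul, mul_assoc, mul_assoc, ← Real.exp_add, ← Real.exp_add]
    refine mul_le_mul_of_nonneg_left (Real.exp_le_exp.2 ?_) (by positivity)
    have hy' : (M : ℝ) ≤ y := by exact_mod_cast hy
    have := mul_le_mul_of_nonneg_left hy' hl0.le
    linarith
  · exact zero_le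

theorem exists_regret_bound_subexponentialPriors {k : ℕ} (hk : 1 ≤ k) {s : ℝ} (hs : 0 < s) :
    ∃ C : ℝ, 0 < C ∧ ∀ (n : ℕ) (hn : 0 < n), 2 ≤ n → ∀ T : (Fin n → ℕ) → Fin n → ℝ,
      IsERM monotoneClass k n T → ∀ π ∈ subexponentialPriors s,
      individualRegret k n hn π T ≤ ((C * (Real.log n ^ (2 * k + 1) / (n : ℝ)) : ℝ) : EReal) := by
  set l := Real.log (1 + 1 / (2 * s)) / 2 with hl
  have hs' : 0 < 1 / (2 * s) := by positivity
  have hl0 : 0 < l := by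
    have := Real.log_pos (show 1 < 1 + 1 / (2 * s) by linarith)
    positivity
  have hlexp : Real.exp (2 * l) = 1 + 1 / (2 * s) := by
    rw [hl, mul_div_cancel₀ _ two_ne_zero, Real.exp_log (by linarith)]
  have hlog2 : 0 < Real.log 2 := Real.log_pos one_lt_two
  have hS := subexpMoment_nonneg
  -- With `M ≥ a log n`, the summand `4s` gives `n exp (-M / (4s)) ≤ 1` and `2 / l` gives `n² exp
  -- (-l M) ≤ 1`.
  set a := 4 * s + 2 / l with ha
  have ha0 : 0 < a := by positivity
  -- Absorbs the rounding of `M` and the shift by `k`, using `log n ≥ log 2`.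
  set a' := a + (1 + k) / Real.log 2 with ha'
  set C₁ := ((2 * k).factorial : ℝ) / (1 / (4 * s)) ^ (2 * k) * subexpMoment with hC₁
  set C₂ := ((2 * k).factorial : ℝ) / l ^ (2 * k) * Real.exp (l * k) * subexpMoment with hC₂
  have hC₁0 : 0 ≤ C₁ := by positivity
  have hC₂0 : 0 ≤ C₂ := by positivity
  have ha'0 : 0 < a' := by positivity
  refine ⟨7 * a' ^ (2 * k + 1) + (5 * C₁ + 9 * C₂) / Real.log 2 ^ (2 * k + 1), by positivity,
    fun n hn hn2 T hT π hπ => ?_⟩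
  have hn' : (0 : ℝ) < n := by exact_mod_cast hn
  have hlogn : Real.log 2 ≤ Real.log n := Real.log_le_log two_pos (by exact_mod_cast hn2)
  have hlogn0 : 0 < Real.log n := by linarith
  rw [← mul_div_assoc]
  refine individualRegret_le_of_lintegral_sum_le π convex_monotoneClass hT (by positivity) ?_
  set M := ⌈a * Real.log n⌉₊
  have hM1 : a * Real.log n ≤ M := Nat.le_ceil _
  have hM2 : (M : ℝ) + k ≤ a' * Real.log n := by
    have h1 := (Nat.ceil_lt_add_one (show 0 ≤ a * Real.log n by positivity)).le
    have h2 : (1 + k : ℝ) ≤ (1 + k) / Real.log 2 * Real.log n := by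
      rw [div_mul_eq_mul_div, le_div_iff₀ hlog2]
      exact mul_le_mul_of_nonneg_left hlogn (by positivity)
    rw [ha', add_mul]
    linarith
  have hE1 : (n : ℝ) * Real.exp (-(1 / (4 * s) * M)) ≤ 1 := by
    rw [← Real.exp_log hn', ← Real.exp_add, Real.exp_le_one_iff]
    have h1 : 4 * s * Real.log n ≤ M :=
      le_trans (mul_le_mul_of_nonneg_right (by rw [ha]; linarith [div_pos two_pos hl0]) hlogn0.le)
        hM1
    have h2 : Real.log n ≤ 1 / (4 * s) * M := by
      rw [div_mul_eq_mul_div, one_mul, le_div_iff₀ (by positivity)]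
      linarith
    linarith
  have hE2 : (n : ℝ) ^ 2 * Real.exp (-(l * M)) ≤ 1 := by
    rw [← Real.exp_log (pow_pos hn' 2), ← Real.exp_add, Real.log_pow, Real.exp_le_one_iff]
    have h1 : 2 / l * Real.log n ≤ M :=
      le_trans (mul_le_mul_of_nonneg_right (by rw [ha]; linarith) hlogn0.le) hM1
    rw [div_mul_eq_mul_div, div_le_iff₀ hl0] at h1
    push_cast
    linarith
  refine (lintegral_sum_sq_le_truncated π hk hn hT M).trans ?_
  have hT1 : 5 * ((n : ℝ≥0∞) * ∫⁻ θ, (if (M : ℝ) ≤ θ then ENNReal.ofReal ((θ : ℝ) ^ (2 * k)) else 0)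
      ∂(π : Measure ℝ≥0)) ≤ ENNReal.ofReal (5 * C₁) := by
    rw [ENNReal.ofReal_mul (by norm_num), ENNReal.ofReal_ofNat]
    refine mul_le_mul_right ((mul_le_mul_right (lintegral_prior_tail_le hs hπ (2 * k) M) _).trans
      ?_) _
    rw [← ENNReal.ofReal_natCast n, ← ENNReal.ofReal_mul hn'.le]
    refine ENNReal.ofReal_le_ofReal ?_
    calc _ = (n : ℝ) * Real.exp (-(1 / (4 * s) * M)) * C₁ := by rw [hC₁]; ring
      _ ≤ 1 * C₁ := mul_le_mul_of_nonneg_right hE1 hC₁0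
      _ = C₁ := one_mul _
  have hT2 : 9 * ((n : ℝ≥0∞) ^ 2 * ∫⁻ y, (if M ≤ y then ENNReal.ofReal ((y + k : ℝ) ^ (2 * k))
      else 0) ∂(obsLaw π)) ≤ ENNReal.ofReal (9 * C₂) := by
    rw [ENNReal.ofReal_mul (by norm_num), ENNReal.ofReal_ofNat]
    refine mul_le_mul_right ((mul_le_mul_right
      (lintegral_obsLaw_tail_le hs hπ hl0 hlexp k (2 * k) M) _).trans ?_) _
    rw [← ENNReal.ofReal_natCast n, ← ENNReal.ofReal_pow hn'.le,
      ← ENNReal.ofReal_mul (by positivity)]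
    refine ENNReal.ofReal_le_ofReal ?_
    calc _ = (n : ℝ) ^ 2 * Real.exp (-(l * M)) * C₂ := by rw [hC₂]; ring
      _ ≤ 1 * C₂ := mul_le_mul_of_nonneg_right hE2 hC₂0
      _ = C₂ := one_mul _
  refine (add_le_add (add_le_add le_rfl hT1) hT2).trans ?_
  rw [← ENNReal.ofReal_add (by positivity) (by positivity),
    ← ENNReal.ofReal_add (by positivity) (by positivity)]
  refine ENNReal.ofReal_le_ofReal ?_
  have h1 : (M + k : ℝ) ^ (2 * k + 1) ≤ a' ^ (2 * k + 1) * Real.log n ^ (2 * k + 1) := by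
    rw [← mul_pow]
    exact pow_le_pow_left₀ (by positivity) hM2 _
  have h2 : 5 * C₁ + 9 * C₂
      ≤ (5 * C₁ + 9 * C₂) / Real.log 2 ^ (2 * k + 1) * Real.log n ^ (2 * k + 1) := by
    rw [div_mul_eq_mul_div, le_div_iff₀ (by positivity)]
    exact mul_le_mul_of_nonneg_left (pow_le_pow_left₀ hlog2.le hlogn _) (by positivity)
  rw [add_mul]
  linarith

end PoissonEB

theorem mainTheorem6 :
    -- the estimators exist
    (∀ k n : ℕ, (∃ T, IsERM monotoneClass k n T) ∧
      ∀ h : ℝ≥0, ∃ T, IsERM (clippedMonotoneClass 0 ((h : ℝ) ^ k)) k n T) ∧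
    -- bounded priors, explicit bound with absolute constants
    (∃ A B : ℝ, 0 < A ∧ 0 < B ∧
      ∀ (k : ℕ), 2 ≤ k → ∀ (h : ℝ≥0) (n : ℕ) (hn : 3 ≤ n) (T : (Fin n → ℕ) → Fin n → ℝ),
        IsERM (clippedMonotoneClass 0 ((h : ℝ) ^ k)) k n T →
        (⨆ π ∈ boundedPriors h, individualRegret k n (by omega) π T) ≤
          (((A + B * h) ^ (2 * k + 1) * (1 / (n : ℝ)) *
                (Real.log n / Real.log (Real.log n)) ^ (k + 1) +
              (2 * (A * h + B * (h : ℝ) ^ 2) * (Real.log n / Real.log (Real.log n)) *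
                (1 + 2 * (k : ℝ))) ^ k / (n : ℝ) ^ 3 : ℝ) : EReal)) ∧
    -- bounded priors, rate
    (∀ (k : ℕ), 1 ≤ k → ∀ h : ℝ≥0, ∃ C : ℝ, 0 < C ∧
      ∀ (n : ℕ) (hn : 3 ≤ n) (T : (Fin n → ℕ) → Fin n → ℝ),
        IsERM (clippedMonotoneClass 0 ((h : ℝ) ^ k)) k n T →
        (⨆ π ∈ boundedPriors h, individualRegret k n (by omega) π T) ≤
          ((C * ((1 / (n : ℝ)) *
            (Real.log n / Real.log (Real.log n)) ^ (k + 1)) : ℝ) : EReal)) ∧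
    -- subexponential priors, rate
    (∀ (k : ℕ), 1 ≤ k → ∀ s : ℝ, 0 < s → ∃ C : ℝ, 0 < C ∧
      ∀ (n : ℕ) (hn : 2 ≤ n) (T : (Fin n → ℕ) → Fin n → ℝ),
        IsERM monotoneClass k n T →
        (⨆ π ∈ subexponentialPriors s, individualRegret k n (by omega) π T) ≤
          ((C * (Real.log n ^ (2 * k + 1) / (n : ℝ)) : ℝ) : EReal)) := by
  refine ⟨fun k n => ⟨exists_isERM (exists_isMinOn_monotoneClass k), fun h =>
    exists_isERM fun x => exists_isMinOn_clippedMonotoneClass k x (by positivity)⟩,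
    ⟨70, 28, by norm_num, by norm_num, fun k hk h n hn T hT => iSup₂_le fun π hπ => ?_⟩,
    fun k hk h => ⟨(70 + 28 * (h : ℝ)) ^ (2 * k + 1), by positivity,
      fun n hn T hT => iSup₂_le fun π hπ => ?_⟩,
    fun k hk s hs => ?_⟩
  · refine (individualRegret_le_of_mem_boundedPriors hπ (by omega) hn hT).trans
      (EReal.coe_le_coe_iff.2 ?_)
    have hu := one_lt_log_of_three_le hn
    have hL : 0 < Real.log n / Real.log (Real.log n) := div_pos (by linarith) (Real.log_pos hu)
    have h0 : 0 ≤ (2 * (70 * (h : ℝ) + 28 * (h : ℝ) ^ 2)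
        * (Real.log n / Real.log (Real.log n)) * (1 + 2 * (k : ℝ))) ^ k / (n : ℝ) ^ 3 := by
      positivity
    -- The first term alone bounds the regret; the second is merely nonnegative.
    refine le_trans (le_of_eq ?_) (le_add_of_nonneg_right h0)
    ring
  · refine (individualRegret_le_of_mem_boundedPriors hπ hk hn hT).trans
      (EReal.coe_le_coe_iff.2 (le_of_eq ?_))
    ring
  · obtain ⟨C, hC, h⟩ := exists_regret_bound_subexponentialPriors hk hs
    exact ⟨C, hC, fun n hn T hT => iSup₂_le fun π hπ => h n (by omega) hn T hT π hπ⟩
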